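/- Let $K$ be an algebraically closed field that is complete with respect to a nontrivial nonarchimedean absolute value $|\cdot|$, let $D=\{z\in K: |z|<1\}$, and let $H^\infty$ be the algebra of bounded analytic functions $f:D\to K$ (functions given on $D$ by a convergent power series $\sum_{n\ge 0} a_nz^n$ and bounded on $D$), normed by $\|f\|=\sup_{z\in D}|f(z)|$. Let $\mathcal M(H^\infty)$ be its Berkovich space, i.e. the set of all multiplicative ring seminorms $\varphi:H^\infty\to[0,\infty)$ with $\varphi(1)=1$ and $\varphi(f)\le\|f\|$ for all $f$, with the topology of pointwise convergence and the pointwise order $\le$; write $\ker\varphi=\{f:\varphi(f)=0\}$, an ideal of $H^\infty$. Let $\mathcal F$ be a nonprincipal ultrafilter on $\mathbb N$ and let $\mathbf z=(z_n)$ be a sequence in $D$ that is regular with respect to $\mathcal F$, i.e. there is $C\in\mathcal F$ with $$\inf_{n\in C}\ \prod_{m\in C,\,m\ne n}|z_n-z_m|>0 .$$ Let $\delta_{\mathbf z,\mathcal F}(f)=\lim_{\mathcal F}|f(z_n)|$ for $f\in H^\infty$. **Theorem.** Both $\delta_{\mathbf z,\mathcal F}$ and the sup norm $\|\cdot\|$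 belong to $\mathcal M(H^\infty)$, and there is a compact, connected subset $A\subset\mathcal M(H^\infty)$, linearly ordered by $\le$, with $\min A=\delta_{\mathbf z,\mathcal F}$ and $\max A=\|\cdot\|$, such that for every $\varphi\in A\setminus\{\delta_{\mathbf z,\mathcal F},\|\cdot\|\}$ the ideal $\ker\varphi$ is nonzero and not maximal. -/

import Mathlib

open Filter Topology
open scoped BoundedContinuousFunction

noncomputable section

/-- The open unit disk `{z ∈ K : ‖z‖ < 1}`, as a type. -/
abbrev UnitDisk (K : Type*) [NormedField K] : Type _ := Metric.ball (0 : K) 1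

section PowerSeriesFunctions

variable {K : Type*} [NormedField K]

/-- A function on the open unit disk is analytic if it is the sum of one power series
`∑ aₙ zⁿ` that converges at every point of the disk. -/
def IsAnalyticOnDisk (f : UnitDisk K → K) : Prop :=
  ∃ a : ℕ → K, ∀ z : UnitDisk K, HasSum (fun n => a n * (z : K) ^ n) (f z)

theorem IsAnalyticOnDisk.const (c : K) :
    IsAnalyticOnDisk (fun _ : UnitDisk K => c) := by
  refine ⟨fun n => if n = 0 then c else 0, fun z => ?_⟩
  convert hasSum_ite_eq (0 : ℕ) c using 2 with n
  by_cases h : n = 0 <;> simp [h]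

theorem IsAnalyticOnDisk.add {f g : UnitDisk K → K} (hf : IsAnalyticOnDisk f)
    (hg : IsAnalyticOnDisk g) : IsAnalyticOnDisk (fun z => f z + g z) := by
  obtain ⟨a, ha⟩ := hf
  obtain ⟨b, hb⟩ := hg
  refine ⟨fun n => a n + b n, fun z => ?_⟩
  simpa only [add_mul] using (ha z).add (hb z)

/-- Cauchy product of convergent series over a complete nonarchimedean field. -/
theorem hasSum_cauchyProduct [CompleteSpace K] [IsUltrametricDist K] {u v : ℕ → K} {x y : K}
    (hu : HasSum u x) (hv : HasSum v y) :
    HasSum (fun n => ∑ p ∈ Finset.HasAntidiagonal.antidiagonal n, u p.1 * v p.2) (x * y) := by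
  have : NonarchimedeanRing K :=
    { is_nonarchimedean := NonarchimedeanAddGroup.is_nonarchimedean }
  have h1 : Summable fun i : ℕ × ℕ => u i.1 * v i.2 :=
    hu.summable.mul_of_nonarchimedean hv.summable
  have hs := summable_sum_mul_antidiagonal_of_summable_mul h1
  have ht := hu.summable.tsum_mul_tsum_eq_tsum_sum_antidiagonal hv.summable h1
  rw [hu.tsum_eq, hv.tsum_eq] at ht
  rw [ht]
  exact hs.hasSum

theorem IsAnalyticOnDisk.mul [CompleteSpace K] [IsUltrametricDist K] {f g : UnitDisk K → K}
    (hf : IsAnalyticOnDisk f) (hg : IsAnalyticOnDisk g) :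
    IsAnalyticOnDisk (fun z => f z * g z) := by
  obtain ⟨a, ha⟩ := hf
  obtain ⟨b, hb⟩ := hg
  refine ⟨fun n => ∑ p ∈ Finset.HasAntidiagonal.antidiagonal n, a p.1 * b p.2, fun z => ?_⟩
  have h := hasSum_cauchyProduct (ha z) (hb z)
  have e : (fun n => (∑ p ∈ Finset.HasAntidiagonal.antidiagonal n, a p.1 * b p.2) * (z : K) ^ n) =
      fun n => ∑ p ∈ Finset.HasAntidiagonal.antidiagonal n,
        a p.1 * (z : K) ^ p.1 * (b p.2 * (z : K) ^ p.2) := by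
    funext n
    rw [Finset.sum_mul]
    refine Finset.sum_congr rfl fun p hp => ?_
    rw [← Finset.HasAntidiagonal.mem_antidiagonal.mp hp, pow_add]
    ring
  rw [e]
  exact h

end PowerSeriesFunctions

/-- `H^∞`: the algebra of bounded analytic functions on the open unit disk, with pointwise
operations. It carries the sup norm, inherited from the bounded continuous functions (a convergent
power series is automatically continuous on the disk). -/
def HInfinity (K : Type*) [NormedField K] [CompleteSpace K] [IsUltrametricDist K] :
    Subalgebra K (UnitDisk K →ᵇ K) where
  carrier := {f | IsAnalyticOnDisk f}
  mul_mem' hf hg := hf.mul hg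
  add_mem' hf hg := hf.add hg
  algebraMap_mem' c := IsAnalyticOnDisk.const c

/-- The Berkovich space `𝓜(A)`: the multiplicative ring seminorms `φ` on `A` with `φ a ≤ ‖a‖`
for all `a`. -/
def BerkovichSpace (A : Type*) [NormedCommRing A] : Type _ :=
  {φ : MulRingSeminorm A // ∀ a, φ a ≤ ‖a‖}

namespace BerkovichSpace

variable {A : Type*} [NormedCommRing A]

instance : CoeFun (BerkovichSpace A) (fun _ => A → ℝ) := ⟨fun φ => φ.1⟩

/-- The topology of simple (pointwise) convergence. -/
instance : TopologicalSpace (BerkovichSpace A) :=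
  TopologicalSpace.induced (fun (φ : BerkovichSpace A) (a : A) => φ a) inferInstance

/-- The pointwise order. -/
instance : PartialOrder (BerkovichSpace A) :=
  PartialOrder.lift (fun (φ : BerkovichSpace A) (a : A) => φ a) fun _ _ h =>
    Subtype.ext (DFunLike.coe_injective h)

/-- The kernel `{a ∈ A : φ a = 0}` as an ideal. -/
def ker (φ : BerkovichSpace A) : Ideal A where
  carrier := {a | φ a = 0}
  zero_mem' := map_zero φ.1
  add_mem' {a b} ha hb := by
    have ha' : φ.1 a = 0 := ha
    have hb' : φ.1 b = 0 := hb
    have h := map_add_le_add φ.1 a b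
    rw [ha', hb', add_zero] at h
    exact le_antisymm h (apply_nonneg φ.1 _)
  smul_mem' c a ha := by
    have ha' : φ.1 a = 0 := ha
    change φ.1 (c * a) = 0
    rw [map_mul, ha', mul_zero]

end BerkovichSpace

/-- A sequence `z` in the open unit disk is regular with respect to an ultrafilter `F` on `ℕ` if
`inf_{n ∈ C} ∏_{m ∈ C, m ≠ n} ‖zₙ - zₘ‖ > 0` for some `C ∈ F`. For nonarchimedean `K` all factors lie in `[0, 1)`, so
the (possibly infinite) products converge unconditionally, and the infimum is over a nonempty
set of reals that is bounded below. -/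
def IsRegularWrt {K : Type*} [NormedField K] (z : ℕ → UnitDisk K) (F : Ultrafilter ℕ) : Prop :=
  ∃ C ∈ F, 0 < ⨅ n : C, ∏' m : {m : ℕ // m ∈ C ∧ m ≠ n}, ‖(z n : K) - (z m : K)‖

end

/-!
The set `A` is the closure of the set of all limits along `F` of seminorms
`f ↦ sup {‖f x‖ : ‖x - z n‖ ≤ r n}` with radii `r n ∈ [0, 1)`. The radii `r n = 0` give `δ`, and
`r n = ‖z n‖` gives the sup norm, because a regular sequence tends to the unit circle. An ultrafilter
decides which of two sequences of radii is the larger one, so `A` is a chain. It is closed in the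
compact space `𝓜(H^∞)`, and connected because, for fixed `n`, the seminorms depend continuously on
the radius, and limits along an ultrafilter of points of connected sets have connected closure
(`isPreconnected_closure_ultralimits`). That suprema over disks of radius `r < 1` are multiplicative
and continuous in `r` is seen by approximation by polynomials, for which they are read off from the
roots (`discSup_aeval`).

*Kernels are not maximal.* For a regular sequence there is `B ∈ H^∞` that, for all `n` in a
member of `F`, vanishes at `z n` and satisfies `sup {‖B x‖ : ‖x - z n‖ ≤ r} ≥ c r`
(`HInfinity.exists_blaschke_product`).
Together with `sup {‖f x‖ : ‖x - z n‖ ≤ r} ≤ ‖f (z n)‖ + r ‖f‖` this gives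
`c φ f ≤ c δ f + φ B ‖f‖` on `A`. So if `φ ≠ δ` then `φ B ≠ 0`, and `ker φ` is strictly smaller than
the proper ideal `ker δ`. As `K` need not be spherically complete, the naive product
`∏ (1 - x / z n)` need not converge; each factor is therefore multiplied by a polynomial which makes
it of the form `1 + O(x ^ N)`, with `N → ∞` so slowly that the norms still have a convergent product,
and whose zeros stay away from all `z m`.

*Kernels are nonzero.* Every `φ ∈ A` agrees with the sup norm on linear polynomials, since already
`δ` does. If `φ f < ‖f‖` for some `f`, division of `f` by its (approximate) zeros in a disk of
radius `R` and multiplication by a truncation of the inverse power series yields functions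
`g = 1 + O(x ^ N)` with `φ g ≤ ρ < 1` and `‖g‖` as close to `1` as desired
(`HInfinity.exists_factor`). A convergent infinite product of such functions is a nonzero element of
`ker φ` (`BerkovichSpace.ker_ne_bot`).
-/

noncomputable section

/-! ### Power series with bounded coefficients -/

section BoundedPowerSeries

variable {K : Type*} [NontriviallyNormedField K]

open PowerSeries

/-- All coefficients of `P` have norm at most `M`. -/
def CoeffBound (P : PowerSeries K) (M : ℝ) : Prop := ∀ n, ‖coeff n P‖ ≤ M

theorem UnitDisk.norm_lt_one (z : UnitDisk K) : ‖(z : K)‖ < 1 := mem_ball_zero_iff.mp z.2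

theorem CoeffBound.nonneg {P : PowerSeries K} {M : ℝ} (h : CoeffBound P M) : 0 ≤ M :=
  (norm_nonneg _).trans (h 0)

theorem CoeffBound.mono {P : PowerSeries K} {M M' : ℝ} (h : CoeffBound P M) (hM : M ≤ M') :
    CoeffBound P M' := fun n => (h n).trans hM

theorem CoeffBound.one : CoeffBound (1 : PowerSeries K) 1 := fun n => by
  rw [coeff_one]
  split_ifs <;> simp

variable [IsUltrametricDist K]

theorem norm_add_le_of_le_of_le {x y : K} {M : ℝ} (hx : ‖x‖ ≤ M) (hy : ‖y‖ ≤ M) :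
    ‖x + y‖ ≤ M := (IsUltrametricDist.norm_add_le_max x y).trans (max_le hx hy)

theorem norm_sub_le_of_le_of_le {x y : K} {M : ℝ} (hx : ‖x‖ ≤ M) (hy : ‖y‖ ≤ M) :
    ‖x - y‖ ≤ M := by
  rw [sub_eq_add_neg]
  exact norm_add_le_of_le_of_le hx (by rwa [norm_neg])

theorem norm_add_eq_left_of_norm_lt {x y : K} (h : ‖y‖ < ‖x‖) : ‖x + y‖ = ‖x‖ := by
  rw [IsUltrametricDist.norm_add_eq_max_of_norm_ne_norm h.ne', max_eq_left h.le]

theorem norm_sub_eq_left_of_norm_lt {x y : K} (h : ‖y‖ < ‖x‖) : ‖x - y‖ = ‖x‖ := by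
  rw [sub_eq_add_neg]
  exact norm_add_eq_left_of_norm_lt (by rwa [norm_neg])

theorem norm_le_of_hasSum {u : ℕ → K} {x : K} {M : ℝ} (hu : HasSum u x)
    (h : ∀ n, ‖u n‖ ≤ M) : ‖x‖ ≤ M := by
  rw [← hu.tsum_eq]
  exact IsUltrametricDist.norm_tsum_le_of_forall_le h

theorem CoeffBound.add {P Q : PowerSeries K} {M : ℝ} (hP : CoeffBound P M)
    (hQ : CoeffBound Q M) : CoeffBound (P + Q) M := fun n => by
  rw [map_add]
  exact norm_add_le_of_le_of_le (hP n) (hQ n)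

/-- The Gauss norm is submultiplicative. -/
theorem CoeffBound.mul {P Q : PowerSeries K} {M M' : ℝ} (hP : CoeffBound P M)
    (hQ : CoeffBound Q M') : CoeffBound (P * Q) (M * M') := fun n => by
  rw [coeff_mul]
  refine IsUltrametricDist.norm_sum_le_of_forall_le_of_nonneg
    (mul_nonneg hP.nonneg hQ.nonneg) fun p _ => ?_
  rw [norm_mul]
  exact mul_le_mul (hP _) (hQ _) (norm_nonneg _) hP.nonneg

omit [IsUltrametricDist K] in
theorem CoeffBound.norm_term_le {P : PowerSeries K} {M : ℝ} (h : CoeffBound P M) {z : K}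
    (hz : ‖z‖ ≤ 1) (n : ℕ) : ‖coeff n P * z ^ n‖ ≤ M := by
  rw [norm_mul, norm_pow]
  calc _ ≤ M * 1 := mul_le_mul (h n) (pow_le_one₀ (norm_nonneg _) hz) (by positivity) h.nonneg
    _ = M := mul_one M

theorem norm_pow_sub_pow_le {x y : K} (hx : ‖x‖ ≤ 1) (hy : ‖y‖ ≤ 1) (n : ℕ) :
    ‖x ^ n - y ^ n‖ ≤ ‖x - y‖ := by
  rw [← (Commute.all x y).geom_sum₂_mul n, norm_mul]
  refine mul_le_of_le_one_left (norm_nonneg _) ?_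
  refine IsUltrametricDist.norm_sum_le_of_forall_le_of_nonneg zero_le_one fun i _ => ?_
  rw [norm_mul, norm_pow, norm_pow]
  exact mul_le_one₀ (pow_le_one₀ (norm_nonneg _) hx) (by positivity)
    (pow_le_one₀ (norm_nonneg _) hy)

variable [CompleteSpace K]

theorem CoeffBound.summable {P : PowerSeries K} {M : ℝ} (h : CoeffBound P M) {z : K}
    (hz : ‖z‖ < 1) : Summable fun n => coeff n P * z ^ n := by
  apply NonarchimedeanAddGroup.summable_of_tendsto_cofinite_zero
  rw [Nat.cofinite_eq_atTop]
  refine squeeze_zero_norm (a := fun n => M * ‖z‖ ^ n) (fun n => ?_) ?_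
  · rw [norm_mul, norm_pow]
    exact mul_le_mul_of_nonneg_right (h n) (by positivity)
  · simpa using (tendsto_pow_atTop_nhds_zero_of_lt_one (norm_nonneg z) hz).const_mul M

namespace HInfinity

@[simp] theorem add_apply (f g : HInfinity K) (z : UnitDisk K) : (f + g).1 z = f.1 z + g.1 z := rfl

@[simp] theorem sub_apply (f g : HInfinity K) (z : UnitDisk K) : (f - g).1 z = f.1 z - g.1 z := rfl

@[simp] theorem mul_apply (f g : HInfinity K) (z : UnitDisk K) : (f * g).1 z = f.1 z * g.1 z := rfl

@[simp] theorem algebraMap_apply (c : K) (z : UnitDisk K) :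
    (algebraMap K (HInfinity K) c).1 z = c := rfl

end HInfinity

/-- `P` is a power series expansion of `f` on the whole unit disk. -/
def Represents (P : PowerSeries K) (f : HInfinity K) : Prop :=
  ∀ z : UnitDisk K, HasSum (fun n => coeff n P * (z : K) ^ n) (f.1 z)

/-- A power series with coefficients bounded by `M` defines an element of `H^∞` of norm at
most `M`. -/
theorem CoeffBound.exists_represents {P : PowerSeries K} {M : ℝ} (h : CoeffBound P M) :
    ∃ f : HInfinity K, Represents P f ∧ ‖f‖ ≤ M := by
  have hs : ∀ z : UnitDisk K, HasSum (fun n => coeff n P * (z : K) ^ n)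
      (∑' n, coeff n P * (z : K) ^ n) := fun z => (h.summable z.norm_lt_one).hasSum
  have hlip : LipschitzWith M.toNNReal
      (fun z : UnitDisk K => ∑' n, coeff n P * (z : K) ^ n) := by
    refine LipschitzWith.of_dist_le_mul fun x y => ?_
    rw [Real.coe_toNNReal _ h.nonneg, dist_eq_norm, Subtype.dist_eq, dist_eq_norm]
    refine norm_le_of_hasSum ((hs x).sub (hs y)) fun n => ?_
    rw [← mul_sub, norm_mul]
    exact mul_le_mul (h n) (norm_pow_sub_pow_le x.norm_lt_one.le y.norm_lt_one.le n)
      (norm_nonneg _) h.nonneg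
  have hb : ∀ z : UnitDisk K, ‖∑' n, coeff n P * (z : K) ^ n‖ ≤ M := fun z =>
    norm_le_of_hasSum (hs z) fun n => h.norm_term_le z.norm_lt_one.le n
  let f : UnitDisk K →ᵇ K := BoundedContinuousFunction.ofNormedAddCommGroup _ hlip.continuous M hb
  exact ⟨⟨f, ⟨fun n => coeff n P, hs⟩⟩, hs,
    BoundedContinuousFunction.norm_ofNormedAddCommGroup_le _ h.nonneg hb⟩

theorem HInfinity.exists_represents (f : HInfinity K) : ∃ P, Represents P f := by
  obtain ⟨a, ha⟩ := f.2
  exact ⟨PowerSeries.mk a, fun z => by simpa using ha z⟩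

theorem HInfinity.norm_apply_le (f : HInfinity K) (z : UnitDisk K) : ‖f.1 z‖ ≤ ‖f‖ :=
  f.1.norm_coe_le_norm z

theorem HInfinity.norm_le_iff {f : HInfinity K} {M : ℝ} (hM : 0 ≤ M) :
    ‖f‖ ≤ M ↔ ∀ z, ‖f.1 z‖ ≤ M :=
  BoundedContinuousFunction.norm_le (f := f.1) hM

theorem HInfinity.ext_apply {f g : HInfinity K} (h : ∀ z, f.1 z = g.1 z) : f = g :=
  Subtype.ext (BoundedContinuousFunction.ext h)

theorem Represents.unique {P : PowerSeries K} {f g : HInfinity K} (hf : Represents P f)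
    (hg : Represents P g) : f = g :=
  HInfinity.ext_apply fun z => (hf z).unique (hg z)

theorem Represents.norm_le {P : PowerSeries K} {f : HInfinity K} {M : ℝ} (hf : Represents P f)
    (h : CoeffBound P M) : ‖f‖ ≤ M := by
  obtain ⟨g, hg, hgM⟩ := h.exists_represents
  rwa [hf.unique hg]

theorem Represents.add {P Q : PowerSeries K} {f g : HInfinity K} (hf : Represents P f)
    (hg : Represents Q g) : Represents (P + Q) (f + g) := fun z => by
  simpa only [map_add, add_mul, HInfinity.add_apply] using (hf z).add (hg z)

theorem Represents.sub {P Q : PowerSeries K} {f g : HInfinity K} (hf : Represents P f)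
    (hg : Represents Q g) : Represents (P - Q) (f - g) := fun z => by
  simpa only [map_sub, sub_mul, HInfinity.sub_apply] using (hf z).sub (hg z)

theorem Represents.mul {P Q : PowerSeries K} {f g : HInfinity K} (hf : Represents P f)
    (hg : Represents Q g) : Represents (P * Q) (f * g) := fun z => by
  have h := hasSum_cauchyProduct (hf z) (hg z)
  rw [HInfinity.mul_apply]
  convert h using 2 with n
  rw [coeff_mul, Finset.sum_mul]
  refine Finset.sum_congr rfl fun p hp => ?_
  rw [← Finset.HasAntidiagonal.mem_antidiagonal.mp hp, pow_add]
  ring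

theorem represents_algebraMap (c : K) : Represents (C c) (algebraMap K (HInfinity K) c) :=
  fun z => by
    rw [HInfinity.algebraMap_apply]
    convert hasSum_ite_eq (0 : ℕ) c using 2 with n
    rw [coeff_C]
    split_ifs with h <;> simp [h]

theorem Represents.apply_zero {P : PowerSeries K} {f : HInfinity K} (hf : Represents P f) :
    f.1 ⟨0, by simp⟩ = coeff 0 P := by
  refine (hf ⟨0, by simp⟩).unique ?_
  convert hasSum_ite_eq (0 : ℕ) (coeff 0 P) using 2 with n
  split_ifs with h <;> simp [h]

/-- The coordinate function of the unit disk. -/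
def HInfinity.coord (K : Type*) [NontriviallyNormedField K] [CompleteSpace K]
    [IsUltrametricDist K] : HInfinity K :=
  ⟨BoundedContinuousFunction.ofNormedAddCommGroup (fun z : UnitDisk K => (z : K))
      continuous_subtype_val 1 fun z => z.norm_lt_one.le,
    ⟨fun n => if n = 1 then 1 else 0, fun z => by
      change HasSum _ (z : K)
      convert hasSum_ite_eq (1 : ℕ) (z : K) using 2 with n
      by_cases h : n = 1 <;> simp [h]⟩⟩

open HInfinity

@[simp] theorem HInfinity.coord_apply (z : UnitDisk K) : (coord K).1 z = z := rfl

theorem represents_coord : Represents (X : PowerSeries K) (coord K) := fun z => by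
  rw [coord_apply]
  convert hasSum_ite_eq (1 : ℕ) (z : K) using 2 with n
  rw [coeff_X]
  by_cases h : n = 1 <;> simp [h]

theorem HInfinity.aeval_coord_apply (p : Polynomial K) (z : UnitDisk K) :
    (Polynomial.aeval (coord K) p).1 z = p.eval (z : K) := by
  induction p using Polynomial.induction_on' with
  | add p q hp hq => simp only [map_add, Polynomial.eval_add, ← hp, ← hq]; rfl
  | monomial n a =>
    rw [Polynomial.aeval_monomial, Polynomial.eval_monomial]
    change a * ((HInfinity.coord K ^ n).1 z) = _
    congr 1

theorem represents_polynomial (p : Polynomial K) :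
    Represents (p : PowerSeries K) (Polynomial.aeval (HInfinity.coord K) p) := fun z => by
  rw [aeval_coord_apply, Polynomial.eval_eq_sum_range]
  simp only [Polynomial.coeff_coe]
  refine hasSum_sum_of_ne_finset_zero fun n hn => ?_
  rw [Polynomial.coeff_eq_zero_of_natDegree_lt (by simpa using hn), zero_mul]

end BoundedPowerSeries

/-! ### Polynomials on disks -/

section PolynomialsOnDisks

open Polynomial

variable {K : Type*} [NontriviallyNormedField K]

theorem norm_multiset_prod_eq {ι : Type*} (s : Multiset ι) (f : ι → K) :
    ‖(s.map f).prod‖ = (s.map fun i => ‖f i‖).prod := by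
  have := map_multiset_prod (normHom (α := K)) (s.map f)
  simpa [Multiset.map_map] using this

/-- The supremum of `‖p‖` over the disk of center `w` and radius `r`, computed from the roots
of `p`. -/
def rootSup (p : K[X]) (w : K) (r : ℝ) : ℝ :=
  ‖p.leadingCoeff‖ * (p.roots.map fun b => max r ‖w - b‖).prod

theorem rootSup_mul {p q : K[X]} (hp : p ≠ 0) (hq : q ≠ 0) (w : K) (r : ℝ) :
    rootSup (p * q) w r = rootSup p w r * rootSup q w r := by
  simp only [rootSup, leadingCoeff_mul, norm_mul, roots_mul (mul_ne_zero hp hq),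
    Multiset.map_add, Multiset.prod_add]
  ring

theorem continuous_rootSup (p : K[X]) (w : K) : Continuous (rootSup p w) :=
  continuous_const.mul <| continuous_multiset_prod _ fun _ _ => by fun_prop

variable [IsAlgClosed K]

/-- The value group of an algebraically closed field is dense. -/
theorem exists_norm_mem_Ioo {a b : ℝ} (ha : 0 ≤ a) (hab : a < b) :
    ∃ c : K, a < ‖c‖ ∧ ‖c‖ < b := by
  rcases ha.eq_or_lt with rfl | ha
  · exact NormedField.exists_norm_lt K hab
  obtain ⟨x, hx⟩ := NormedField.exists_one_lt_norm K
  obtain ⟨n, hn⟩ := pow_unbounded_of_one_lt ‖x‖ ((one_lt_div ha).mpr hab)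
  have hn0 : n ≠ 0 := by
    rintro rfl
    rw [pow_zero] at hn
    exact lt_asymm hx hn
  obtain ⟨y, hy⟩ := IsAlgClosed.exists_pow_nat_eq x (Nat.pos_of_ne_zero hn0)
  have hyn : ‖y‖ ^ n = ‖x‖ := by rw [← norm_pow, hy]
  have hy1 : 1 < ‖y‖ := by
    by_contra h
    rw [← hyn] at hx
    exact absurd hx (not_lt.mpr (pow_le_one₀ (norm_nonneg _) (not_lt.mp h)))
  have hy2 : ‖y‖ < b / a := by
    rw [← hyn] at hn
    exact lt_of_pow_lt_pow_left₀ n (div_pos (ha.trans hab) ha).le hn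
  obtain ⟨k, hk1, hk2⟩ := exists_mem_Ico_zpow ha hy1
  refine ⟨y ^ (k + 1), by rwa [norm_zpow], ?_⟩
  rw [norm_zpow, zpow_add_one₀ (by positivity)]
  calc ‖y‖ ^ k * ‖y‖ < a * (b / a) := mul_lt_mul' hk1 hy2 (norm_nonneg _) ha
    _ = b := by field_simp

theorem norm_eval_eq (p : K[X]) (z : K) :
    ‖p.eval z‖ = ‖p.leadingCoeff‖ * (p.roots.map fun b => ‖z - b‖).prod := by
  rw [(IsAlgClosed.splits p).eval_eq_prod_roots, norm_mul, norm_multiset_prod_eq]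

variable [IsUltrametricDist K]

omit [IsAlgClosed K] in
theorem norm_sub_le_max_center (z w b : K) : ‖z - b‖ ≤ max ‖z - w‖ ‖w - b‖ := by
  rw [← sub_add_sub_cancel z w b]
  exact IsUltrametricDist.norm_add_le_max _ _

theorem norm_eval_le_rootSup (p : K[X]) {z w : K} {r : ℝ} (h : ‖z - w‖ ≤ r) :
    ‖p.eval z‖ ≤ rootSup p w r := by
  rw [norm_eval_eq, rootSup]
  gcongr
  refine Multiset.prod_map_le_prod_map₀ _ _ (fun _ _ => norm_nonneg _) fun b _ => ?_
  exact (norm_sub_le_max_center z w b).trans (max_le_max h le_rfl)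

/-- The residue field is infinite: some integral `t` avoids the residue classes of finitely many
integral elements. A root of `∏ (X - c) - 1` has this property. -/
theorem exists_norm_sub_eq_one (s : Multiset K) (hs : ∀ c ∈ s, ‖c‖ ≤ 1) :
    ∃ t : K, ‖t‖ ≤ 1 ∧ ∀ c ∈ s, 1 ≤ ‖t - c‖ := by
  classical
  rcases Multiset.empty_or_exists_mem s with rfl | ⟨c₀, hc₀⟩
  · exact ⟨0, by simp⟩
  set P : K[X] := (s.map fun c => X - C c).prod
  have hdeg : P.degree = (Multiset.card s : ℕ) := by
    rw [degree_multiset_prod_of_monic]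
    · simp
    · intro f hf
      obtain ⟨c, -, rfl⟩ := Multiset.mem_map.mp hf
      exact monic_X_sub_C c
  have hcard : 0 < Multiset.card s := Multiset.card_pos_iff_exists_mem.mpr ⟨c₀, hc₀⟩
  obtain ⟨t, ht⟩ := IsAlgClosed.exists_root (P - C 1) (by
    rw [degree_sub_C (by rw [hdeg]; exact_mod_cast hcard), hdeg]
    exact_mod_cast hcard.ne')
  have hprod : (s.map fun c => ‖t - c‖).prod = 1 := by
    have h1 : P.eval t = 1 := by
      simpa [IsRoot, sub_eq_zero] using ht
    have h2 : P.eval t = (s.map fun c => t - c).prod := by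
      rw [eval_multiset_prod, Multiset.map_map]
      simp
    rw [← norm_multiset_prod_eq, ← h2, h1, norm_one]
  have hsplit : ∀ c ∈ s, ‖t - c‖ * ((s.erase c).map fun c => ‖t - c‖).prod = 1 := by
    intro c hc
    rw [← hprod, ← Multiset.prod_cons, ← Multiset.map_cons (fun c => ‖t - c‖),
      Multiset.cons_erase hc]
  have ht1 : ‖t‖ ≤ 1 := by
    by_contra hlt
    have hlt : 1 < ‖t‖ := not_le.mp hlt
    have hnorm : ∀ c ∈ s, ‖t - c‖ = ‖t‖ := fun c hc =>
      norm_sub_eq_left_of_norm_lt ((hs c hc).trans_lt hlt)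
    rw [Multiset.map_congr rfl hnorm, Multiset.map_const', Multiset.prod_replicate] at hprod
    exact (one_lt_pow₀ hlt hcard.ne').ne' hprod
  refine ⟨t, ht1, fun c hc => ?_⟩
  rw [← hsplit c hc]
  refine mul_le_of_le_one_right (norm_nonneg _) ?_
  calc _ ≤ ((s.erase c).map fun _ => (1 : ℝ)).prod := by
        refine Multiset.prod_map_le_prod_map₀ _ _ (fun _ _ => norm_nonneg _) fun b hb => ?_
        exact norm_sub_le_of_le_of_le ht1 (hs b (Multiset.mem_of_mem_erase hb))
    _ = 1 := by simp

/-- A point of the disk of center `w` and radius `r` that is generic, up to a loss from `r`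
to `ρ`, with respect to finitely many points. -/
theorem exists_generic_point (s : Multiset K) (w : K) {ρ r : ℝ} (hρ : 0 ≤ ρ) (hr : ρ < r) :
    ∃ z : K, ‖z - w‖ ≤ r ∧ ∀ b ∈ s, max ρ ‖w - b‖ ≤ ‖z - b‖ := by
  obtain ⟨c, hc1, hc2⟩ := exists_norm_mem_Ioo (K := K) hρ hr
  have hc0 : 0 < ‖c‖ := hρ.trans_lt hc1
  have hc : c ≠ 0 := norm_pos_iff.mp hc0
  obtain ⟨t, ht1, ht2⟩ := exists_norm_sub_eq_one
    (((s.filter fun b => ‖b - w‖ ≤ ‖c‖).map fun b => (b - w) / c)) (by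
      intro x hx
      obtain ⟨b, hb, rfl⟩ := Multiset.mem_map.mp hx
      rw [norm_div, div_le_one hc0]
      exact (Multiset.mem_filter.mp hb).2)
  have hct : ‖c * t‖ ≤ ‖c‖ := by
    rw [norm_mul]
    exact mul_le_of_le_one_right hc0.le ht1
  refine ⟨w + c * t, by rw [add_sub_cancel_left]; exact hct.trans hc2.le, fun b hb => ?_⟩
  rcases le_or_gt ‖b - w‖ ‖c‖ with h | h
  · have h1 := ht2 _ (Multiset.mem_map_of_mem _ (Multiset.mem_filter.mpr ⟨hb, h⟩))
    have h2 : w + c * t - b = c * (t - (b - w) / c) := by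
      field_simp
      ring
    rw [h2, norm_mul, norm_sub_rev w b]
    exact (max_le hc1.le h).trans (le_mul_of_one_le_right hc0.le h1)
  · have h2 : w + c * t - b = c * t - (b - w) := by ring
    rw [h2, norm_sub_rev (c * t),
      norm_sub_eq_left_of_norm_lt (hct.trans_lt h), norm_sub_rev w b]
    exact max_le (hc1.le.trans h.le) le_rfl

theorem exists_rootSup_le_norm_eval (p : K[X]) (w : K) {ρ r : ℝ} (hρ : 0 ≤ ρ) (hr : ρ < r) :
    ∃ z : K, ‖z - w‖ ≤ r ∧ rootSup p w ρ ≤ ‖p.eval z‖ := by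
  obtain ⟨z, hz, h⟩ := exists_generic_point p.roots w hρ hr
  refine ⟨z, hz, ?_⟩
  rw [norm_eval_eq, rootSup]
  gcongr
  exact Multiset.prod_map_le_prod_map₀ _ _ (fun _ _ => hρ.trans (le_max_left _ _)) h

/-- Cauchy's estimate for polynomials. -/
theorem norm_coeff_mul_pow_le_rootSup (p : K[X]) {r : ℝ} (hr : 0 ≤ r) (n : ℕ) :
    ‖p.coeff n‖ * r ^ n ≤ rootSup p 0 r := by
  have key : ∀ (s : Multiset K) (n : ℕ),
      ‖((s.map fun b => X - C b).prod).coeff n‖ * r ^ n ≤ (s.map fun b => max r ‖b‖).prod := by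
    intro s
    induction s using Multiset.induction_on with
    | empty =>
      intro n
      rcases n with _ | n <;> simp [coeff_one]
    | cons b s ih =>
      intro n
      have hnn : 0 ≤ (s.map fun b => max r ‖b‖).prod := Multiset.prod_nonneg fun x hx => by
        obtain ⟨b, -, rfl⟩ := Multiset.mem_map.mp hx
        exact hr.trans (le_max_left _ _)
      rw [Multiset.map_cons, Multiset.prod_cons, Multiset.map_cons, Multiset.prod_cons]
      set Q := (s.map fun b => X - C b).prod
      have hb : ∀ m, ‖b * Q.coeff m‖ * r ^ m ≤
          max r ‖b‖ * (s.map fun b => max r ‖b‖).prod := fun m => by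
        rw [norm_mul, mul_assoc]
        exact mul_le_mul (le_max_right _ _) (ih m) (by positivity) (hr.trans (le_max_left _ _))
      rcases n with _ | n
      · simpa [sub_mul] using hb 0
      · rw [sub_mul, coeff_sub, coeff_X_mul, coeff_C_mul]
        have hX : ‖Q.coeff n‖ * r ^ (n + 1) ≤
            max r ‖b‖ * (s.map fun b => max r ‖b‖).prod := by
          rw [pow_succ, ← mul_assoc, mul_comm]
          exact mul_le_mul (le_max_left _ _) (ih n) (by positivity) (hr.trans (le_max_left _ _))
        rcases le_total ‖Q.coeff n‖ ‖b * Q.coeff (n + 1)‖ with h | h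
        · exact (mul_le_mul_of_nonneg_right (norm_sub_le_of_le_of_le h le_rfl)
            (by positivity)).trans (hb (n + 1))
        · exact (mul_le_mul_of_nonneg_right (norm_sub_le_of_le_of_le le_rfl h)
            (by positivity)).trans hX
  have h := congrArg (fun q => q.coeff n) (IsAlgClosed.splits p).eq_prod_roots
  simp only [coeff_C_mul] at h
  rw [h, norm_mul, mul_assoc, rootSup]
  gcongr
  simpa using key p.roots n

end PolynomialsOnDisks

/-! ### Sup seminorms on smaller disks -/

section DiskSeminorms

open HInfinity

variable {K : Type*} [NontriviallyNormedField K] [CompleteSpace K] [IsUltrametricDist K]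

/-- The supremum of `‖f‖` over the closed disk of center `w` and radius `r` (intersected with the
open unit disk, which changes nothing when `r < 1`). -/
def discSup (w : UnitDisk K) (r : ℝ) (f : HInfinity K) : ℝ :=
  ⨆ z : {z : UnitDisk K // ‖(z : K) - w‖ ≤ r}, ‖f.1 z‖

theorem norm_apply_le_discSup {w z : UnitDisk K} {r : ℝ} (h : ‖(z : K) - w‖ ≤ r)
    (f : HInfinity K) : ‖f.1 z‖ ≤ discSup w r f :=
  le_ciSup (f := fun z : {z : UnitDisk K // ‖(z : K) - w‖ ≤ r} => ‖f.1 z‖)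
    ⟨‖f‖, by rintro _ ⟨z, rfl⟩; exact HInfinity.norm_apply_le f z⟩ ⟨z, h⟩

theorem discSup_le {w : UnitDisk K} {r : ℝ} (hr : 0 ≤ r) {f : HInfinity K} {M : ℝ}
    (h : ∀ z : UnitDisk K, ‖(z : K) - w‖ ≤ r → ‖f.1 z‖ ≤ M) : discSup w r f ≤ M := by
  have : Nonempty {z : UnitDisk K // ‖(z : K) - w‖ ≤ r} := ⟨⟨w, by simpa using hr⟩⟩
  exact ciSup_le fun z => h z z.2

theorem norm_center_le_discSup (w : UnitDisk K) {r : ℝ} (hr : 0 ≤ r) (f : HInfinity K) :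
    ‖f.1 w‖ ≤ discSup w r f := norm_apply_le_discSup (by simpa using hr) f

theorem discSup_nonneg (w : UnitDisk K) {r : ℝ} (hr : 0 ≤ r) (f : HInfinity K) :
    0 ≤ discSup w r f := (norm_nonneg _).trans (norm_center_le_discSup w hr f)

theorem discSup_le_norm (w : UnitDisk K) {r : ℝ} (hr : 0 ≤ r) (f : HInfinity K) :
    discSup w r f ≤ ‖f‖ := discSup_le hr fun z _ => HInfinity.norm_apply_le f z

theorem discSup_mono (w : UnitDisk K) {r s : ℝ} (hr : 0 ≤ r) (hrs : r ≤ s) (f : HInfinity K) :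
    discSup w r f ≤ discSup w s f :=
  discSup_le hr fun _ hz => norm_apply_le_discSup (hz.trans hrs) f

theorem discSup_zero_radius (w : UnitDisk K) (f : HInfinity K) : discSup w 0 f = ‖f.1 w‖ := by
  refine le_antisymm (discSup_le le_rfl fun _ hz => ?_) (norm_center_le_discSup w le_rfl f)
  rw [norm_le_zero_iff, sub_eq_zero] at hz
  rw [Subtype.ext hz]

theorem discSup_add_le (w : UnitDisk K) {r : ℝ} (hr : 0 ≤ r) (f g : HInfinity K) :
    discSup w r (f + g) ≤ discSup w r f + discSup w r g :=
  discSup_le hr fun _ hz => (norm_add_le _ _).trans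
    (add_le_add (norm_apply_le_discSup hz f) (norm_apply_le_discSup hz g))

theorem discSup_neg (w : UnitDisk K) (r : ℝ) (f : HInfinity K) :
    discSup w r (-f) = discSup w r f := by
  unfold discSup
  congr 1
  funext z
  exact norm_neg (f.1 z)

theorem discSup_mul_le (w : UnitDisk K) {r : ℝ} (hr : 0 ≤ r) (f g : HInfinity K) :
    discSup w r (f * g) ≤ discSup w r f * discSup w r g :=
  discSup_le hr fun z hz => by
    rw [mul_apply, norm_mul]
    exact mul_le_mul (norm_apply_le_discSup hz f) (norm_apply_le_discSup hz g) (norm_nonneg _)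
      (discSup_nonneg w hr f)

theorem abs_discSup_sub_le (w : UnitDisk K) {r : ℝ} (hr : 0 ≤ r) (f g : HInfinity K) :
    |discSup w r f - discSup w r g| ≤ discSup w r (f - g) := by
  have h1 := discSup_add_le w hr (f - g) g
  have h2 := discSup_add_le w hr (-(f - g)) f
  rw [sub_add_cancel] at h1
  rw [discSup_neg, neg_sub, sub_add_cancel] at h2
  exact abs_sub_le_iff.mpr ⟨by linarith, by linarith⟩

/-- A closed disk may be recentered at any of its points. -/
theorem discSup_recenter {w w' : UnitDisk K} {r : ℝ} (hr : 0 ≤ r) (h : ‖(w : K) - w'‖ ≤ r)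
    (f : HInfinity K) : discSup w r f = discSup w' r f := by
  refine le_antisymm (discSup_le hr fun z hz => ?_) (discSup_le hr fun z hz => ?_)
  · exact norm_apply_le_discSup ((norm_sub_le_max_center (z : K) w w').trans (max_le hz h)) f
  · exact norm_apply_le_discSup ((norm_sub_le_max_center (z : K) w' w).trans
      (max_le hz (by rwa [norm_sub_rev]))) f

variable [IsAlgClosed K]

theorem discSup_aeval (p : Polynomial K) (w : UnitDisk K) {r : ℝ} (hr : 0 ≤ r) (hr1 : r < 1) :
    discSup w r (Polynomial.aeval (coord K) p) = rootSup p w r := by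
  refine le_antisymm (discSup_le hr fun z hz => ?_) ?_
  · rw [aeval_coord_apply]
    exact norm_eval_le_rootSup p hz
  rcases hr.eq_or_lt with rfl | hr0
  · rw [discSup_zero_radius, aeval_coord_apply, norm_eval_eq, rootSup]
    simp
  · -- The bound holds with `ρ < r` in place of `r`; let `ρ → r`.
    have hlim : Tendsto (rootSup p w) (𝓝[<] r) (𝓝 (rootSup p w r)) :=
      (continuous_rootSup p w).continuousAt.mono_left nhdsWithin_le_nhds
    refine le_of_tendsto hlim ?_
    filter_upwards [Ioo_mem_nhdsLT hr0] with ρ hρ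
    obtain ⟨z, hz, hpz⟩ := exists_rootSup_le_norm_eval p (w : K) hρ.1.le hρ.2
    have hz1 : ‖z‖ < 1 := by
      have h := norm_add_le_of_le_of_le (hz.trans (le_max_left r ‖(w : K)‖)) (le_max_right _ _)
      rw [sub_add_cancel] at h
      exact h.trans_lt (max_lt hr1 w.norm_lt_one)
    have h := norm_apply_le_discSup (z := ⟨z, mem_ball_zero_iff.mpr hz1⟩) hz
      (Polynomial.aeval (coord K) p)
    rw [aeval_coord_apply] at h
    exact hpz.trans h

/-- On a smaller disk, `f` is the uniform limit of the truncations of its power series. -/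
theorem Represents.eventually_norm_sub_trunc_le {P : PowerSeries K} {f : HInfinity K}
    (hf : Represents P f) {R ε : ℝ} (hR : R < 1) (hε : 0 < ε) :
    ∀ᶠ k in atTop, ∀ z : UnitDisk K, ‖(z : K)‖ ≤ R →
      ‖(f - Polynomial.aeval (coord K) (P.trunc k)).1 z‖ ≤ ε := by
  obtain ⟨c, hc1, hc2⟩ := exists_norm_mem_Ioo (K := K) (le_max_right R 0) (max_lt hR zero_lt_one)
  have hz := (hf ⟨c, mem_ball_zero_iff.mpr hc2⟩).summable.tendsto_atTop_zero.norm
  rw [norm_zero] at hz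
  obtain ⟨k₀, hk₀⟩ := eventually_atTop.mp (hz.eventually_le_const hε)
  filter_upwards [eventually_ge_atTop k₀] with k hk z hzR
  refine norm_le_of_hasSum (hf.sub (represents_polynomial (P.trunc k)) z) fun n => ?_
  rw [map_sub, Polynomial.coeff_coe, PowerSeries.coeff_trunc]
  split_ifs with h
  · simpa using hε.le
  · rw [sub_zero]
    refine le_trans ?_ (hk₀ n (hk.trans (not_lt.mp h)))
    rw [norm_mul, norm_mul, norm_pow, norm_pow]
    have : ‖(z : K)‖ ≤ ‖c‖ := hzR.trans ((le_max_left _ _).trans hc1.le)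
    gcongr

theorem Represents.eventually_discSup_sub_trunc_le {P : PowerSeries K} {f : HInfinity K}
    (hf : Represents P f) {R ε : ℝ} (hR : R < 1) (hε : 0 < ε) :
    ∀ᶠ k in atTop, ∀ w : UnitDisk K, ‖(w : K)‖ ≤ R → ∀ r, 0 ≤ r → r ≤ R →
      discSup w r (f - Polynomial.aeval (coord K) (P.trunc k)) ≤ ε := by
  filter_upwards [hf.eventually_norm_sub_trunc_le hR hε] with k hk w hw r hr hrR
  refine discSup_le hr fun z hz => hk z ?_
  have h := norm_add_le_of_le_of_le (hz.trans hrR) hw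
  rwa [sub_add_cancel] at h

theorem Represents.tendsto_discSup_trunc {P : PowerSeries K} {f : HInfinity K}
    (hf : Represents P f) (w : UnitDisk K) {r : ℝ} (hr : 0 ≤ r) (hr1 : r < 1) :
    Tendsto (fun k => discSup w r (Polynomial.aeval (coord K) (P.trunc k))) atTop
      (𝓝 (discSup w r f)) := by
  rw [Metric.tendsto_atTop']
  intro ε hε
  obtain ⟨k₀, hk₀⟩ := eventually_atTop.mp (hf.eventually_discSup_sub_trunc_le
    (max_lt w.norm_lt_one hr1) (half_pos hε))
  refine ⟨k₀, fun k hk => ?_⟩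
  rw [dist_comm, Real.dist_eq]
  exact ((abs_discSup_sub_le w hr _ _).trans
    (hk₀ k hk.le w (le_max_left _ _) r hr (le_max_right _ _))).trans_lt (half_lt_self hε)

theorem continuousOn_discSup (w : UnitDisk K) (f : HInfinity K) :
    ContinuousOn (fun r => discSup w r f) (Set.Ico 0 1) := by
  obtain ⟨P, hP⟩ := HInfinity.exists_represents f
  have key : ∀ R < 1, ‖(w : K)‖ ≤ R → ContinuousOn (fun r => discSup w r f) (Set.Icc 0 R) := by
    intro R hR hw
    have hunif : TendstoUniformlyOn (fun k r => rootSup (P.trunc k) (w : K) r)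
        (fun r => discSup w r f) atTop (Set.Icc 0 R) := by
      rw [Metric.tendstoUniformlyOn_iff]
      intro ε hε
      filter_upwards [hP.eventually_discSup_sub_trunc_le hR (half_pos hε)] with k hk r hr
      rw [← discSup_aeval _ w hr.1 (hr.2.trans_lt hR), Real.dist_eq]
      exact ((abs_discSup_sub_le w hr.1 _ _).trans (hk w hw r hr.1 hr.2)).trans_lt
        (half_lt_self hε)
    exact hunif.continuousOn (Frequently.of_forall fun k => (continuous_rootSup _ _).continuousOn)
  intro r hr
  obtain ⟨R, hR1, hR2⟩ := exists_between (max_lt hr.2 w.norm_lt_one)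
  refine (key R hR2 ((le_max_right _ _).trans hR1.le) r
    ⟨hr.1, (le_max_left _ _).trans hR1.le⟩).mono_of_mem_nhdsWithin ?_
  filter_upwards [self_mem_nhdsWithin,
    nhdsWithin_le_nhds (Iio_mem_nhds ((le_max_left r _).trans_lt hR1))] with s hs hs'
  exact ⟨hs.1, le_of_lt hs'⟩

theorem discSup_mul (w : UnitDisk K) {r : ℝ} (hr : 0 ≤ r) (hr1 : r < 1) (f g : HInfinity K) :
    discSup w r (f * g) = discSup w r f * discSup w r g := by
  obtain ⟨P, hP⟩ := HInfinity.exists_represents f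
  obtain ⟨Q, hQ⟩ := HInfinity.exists_represents g
  set p : ℕ → HInfinity K := fun k => Polynomial.aeval (coord K) (P.trunc k) with hp
  set q : ℕ → HInfinity K := fun k => Polynomial.aeval (coord K) (Q.trunc k) with hq
  have hpq : ∀ k, discSup w r (p k * q k) = discSup w r (p k) * discSup w r (q k) := by
    intro k
    have hzero : discSup w r (0 : HInfinity K) = 0 :=
      le_antisymm (discSup_le hr fun z _ => by simp) (discSup_nonneg w hr _)
    by_cases hP0 : P.trunc k = 0
    · simp [hp, hP0, hzero]
    by_cases hQ0 : Q.trunc k = 0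
    · simp [hq, hQ0, hzero]
    rw [hp, hq]
    simp only [← map_mul]
    rw [discSup_aeval _ w hr hr1, discSup_aeval _ w hr hr1, discSup_aeval _ w hr hr1,
      rootSup_mul hP0 hQ0]
  have h1 := (hP.tendsto_discSup_trunc w hr hr1).mul (hQ.tendsto_discSup_trunc w hr hr1)
  have hsub : ∀ {T : PowerSeries K} {h : HInfinity K}, Represents T h →
      Tendsto (fun k => discSup w r (h - Polynomial.aeval (coord K) (T.trunc k))) atTop (𝓝 0) := by
    intro T h hT
    refine tendsto_order.mpr ⟨fun a ha => Eventually.of_forall fun k =>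
      ha.trans_le (discSup_nonneg w hr _), fun a ha => ?_⟩
    filter_upwards [hT.eventually_discSup_sub_trunc_le (max_lt w.norm_lt_one hr1) (half_pos ha)]
      with k hk
    exact (hk w (le_max_left _ _) r hr (le_max_right _ _)).trans_lt (half_lt_self ha)
  have h2 : Tendsto (fun k => discSup w r (p k * q k)) atTop (𝓝 (discSup w r (f * g))) := by
    rw [tendsto_iff_dist_tendsto_zero]
    refine squeeze_zero (fun _ => dist_nonneg) (fun k => ?_) (g := fun k =>
      discSup w r f * discSup w r (g - q k) + discSup w r (f - p k) * discSup w r (q k)) ?_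
    · rw [dist_comm, Real.dist_eq]
      refine (abs_discSup_sub_le w hr _ _).trans ?_
      have e : f * g - p k * q k = f * (g - q k) + (f - p k) * q k := by ring
      rw [e]
      exact (discSup_add_le w hr _ _).trans
        (add_le_add (discSup_mul_le w hr _ _) (discSup_mul_le w hr _ _))
    · have := ((hsub hQ).const_mul (discSup w r f)).add
        ((hsub hP).mul (hQ.tendsto_discSup_trunc w hr hr1))
      simpa using this
  refine tendsto_nhds_unique h2 ?_
  simpa only [hpq] using h1

/-- Cauchy's estimate. -/
theorem Represents.norm_coeff_mul_pow_le {P : PowerSeries K} {f : HInfinity K}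
    (hf : Represents P f) {r : ℝ} (hr : 0 ≤ r) (hr1 : r < 1) (n : ℕ) :
    ‖PowerSeries.coeff n P‖ * r ^ n ≤ discSup ⟨0, by simp⟩ r f := by
  refine ge_of_tendsto (Represents.tendsto_discSup_trunc hf _ hr hr1) ?_
  filter_upwards [eventually_gt_atTop n] with k hk
  rw [discSup_aeval _ _ hr hr1]
  have h := norm_coeff_mul_pow_le_rootSup (P.trunc k) hr n
  rwa [PowerSeries.coeff_trunc, if_pos hk] at h

theorem Represents.coeffBound {P : PowerSeries K} {f : HInfinity K} (hf : Represents P f) :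
    CoeffBound P ‖f‖ := fun n => by
  have hlim : Tendsto (fun r : ℝ => ‖PowerSeries.coeff n P‖ * r ^ n) (𝓝[<] 1)
      (𝓝 (‖PowerSeries.coeff n P‖ * 1 ^ n)) :=
    ((continuous_const.mul (continuous_pow n)).tendsto 1).mono_left nhdsWithin_le_nhds
  rw [one_pow, mul_one] at hlim
  refine le_of_tendsto hlim ?_
  filter_upwards [Ioo_mem_nhdsLT (zero_lt_one (α := ℝ))] with r hr
  exact (hf.norm_coeff_mul_pow_le hr.1.le hr.2 n).trans (discSup_le_norm _ hr.1.le f)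

theorem HInfinity.exists_division (f : HInfinity K) (b : UnitDisk K) :
    ∃ g : HInfinity K, ‖g‖ ≤ ‖f‖ ∧
      f = algebraMap K _ (f.1 b) + (coord K - algebraMap K _ (b : K)) * g := by
  obtain ⟨P, hP⟩ := HInfinity.exists_represents f
  have hb := hP.coeffBound
  have hsum : ∀ n, Summable fun k => PowerSeries.coeff (n + k) P * (b : K) ^ k := fun n =>
    CoeffBound.summable (P := PowerSeries.mk fun k => PowerSeries.coeff (n + k) P)
      (M := ‖f‖) (fun k => by simpa using hb (n + k)) b.norm_lt_one |>.congr (by simp)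
  set S : ℕ → K := fun n => ∑' k, PowerSeries.coeff (n + k) P * (b : K) ^ k with hS
  have hrec : ∀ n, S n = PowerSeries.coeff n P + b * S (n + 1) := by
    intro n
    simp only [hS]
    rw [(hsum n).tsum_eq_zero_add, ← (hsum (n + 1)).tsum_mul_left]
    simp only [add_zero, pow_zero, mul_one]
    congr 2
    funext k
    rw [add_right_comm, add_assoc n k 1]
    ring
  have hQ : CoeffBound (PowerSeries.mk fun n => S (n + 1)) ‖f‖ := fun n => by
    rw [PowerSeries.coeff_mk]
    refine norm_le_of_hasSum (hsum (n + 1)).hasSum fun k => ?_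
    exact CoeffBound.norm_term_le (P := PowerSeries.mk fun k => PowerSeries.coeff (n + 1 + k) P)
      (fun k => by simpa using hb (n + 1 + k)) b.norm_lt_one.le k |>.trans_eq' (by simp)
  obtain ⟨g, hg, hgn⟩ := hQ.exists_represents
  refine ⟨g, hgn, hP.unique ?_⟩
  have hfb : f.1 b = S 0 := by
    simp only [hS, zero_add]
    exact (hP b).tsum_eq.symm
  have h := (represents_algebraMap (f.1 b)).add
    ((represents_coord.sub (represents_algebraMap (b : K))).mul hg)
  convert h using 1
  ext n
  rw [map_add, sub_mul, map_sub, PowerSeries.coeff_C_mul, PowerSeries.coeff_mk]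
  rcases n with _ | n
  · rw [PowerSeries.coeff_zero_X_mul, PowerSeries.coeff_zero_C, hfb, hrec 0]
    ring
  · rw [PowerSeries.coeff_succ_X_mul, PowerSeries.coeff_mk, hrec (n + 1), PowerSeries.coeff_C,
      if_neg (Nat.succ_ne_zero n)]
    ring

/-- The Lipschitz estimate `‖f(z) - f(w)‖ ≤ ‖z - w‖ ‖f‖` as a bound on disk seminorms. -/
theorem discSup_le_norm_apply_add (w : UnitDisk K) {r : ℝ} (hr : 0 ≤ r) (f : HInfinity K) :
    discSup w r f ≤ ‖f.1 w‖ + r * ‖f‖ := by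
  obtain ⟨g, hg, hfg⟩ := HInfinity.exists_division f w
  refine discSup_le hr fun z hz => ?_
  have h : f.1 z = f.1 w + ((z : K) - w) * g.1 z := by
    conv_lhs => rw [hfg]
    simp
  rw [h]
  refine (norm_add_le _ _).trans (add_le_add_right ?_ _)
  rw [norm_mul]
  exact mul_le_mul hz ((HInfinity.norm_apply_le g z).trans hg) (norm_nonneg _) hr

end DiskSeminorms

/-! ### Ultralimits in compact spaces -/

section Ultralimits

/-- All limits along `F` of families of points of the sets `S i`. -/
def ultralimits {ι X : Type*} [TopologicalSpace X] (F : Ultrafilter ι) (S : ι → Set X) : Set X :=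
  {x | ∃ s : ι → X, (∀ i, s i ∈ S i) ∧ Tendsto s F (𝓝 x)}

theorem Ultrafilter.exists_tendsto {ι X : Type*} [TopologicalSpace X] [CompactSpace X]
    (F : Ultrafilter ι) (s : ι → X) : ∃ x, Tendsto s F (𝓝 x) :=
  ⟨_, (F.map s).le_nhds_lim⟩

/-- In a compact Hausdorff space, the ultralimits of connected sets have connected closure: if two
disjoint open sets `U`, `V` cover the closure, then `F`-almost all of the connected sets lie in
`U ∪ V`, so `F`-almost all of them lie in the same one of the two, and so do their limits. -/
theorem isPreconnected_closure_ultralimits {ι X : Type*} [TopologicalSpace X] [CompactSpace X]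
    [T2Space X] (F : Ultrafilter ι) {S : ι → Set X} (hS : ∀ i, IsConnected (S i)) :
    IsPreconnected (closure (ultralimits F S)) := by
  rw [isPreconnected_closed_iff]
  intro t t' ht ht' hcover hne hne'
  by_contra hempty
  rw [Set.not_nonempty_iff_eq_empty] at hempty
  obtain ⟨U, V, hU, hV, htU, htV, hUV⟩ := normal_separation
    (isClosed_closure.inter ht) (isClosed_closure.inter ht') (by
      rw [Set.disjoint_iff_inter_eq_empty, ← Set.inter_inter_distrib_left]
      exact hempty)
  have hsub : ∀ᶠ i in F, S i ⊆ U ∪ V := by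
    by_contra hnot
    rw [Ultrafilter.eventually_not.symm] at hnot
    have hchoice : ∀ i, ∃ x ∈ S i, ¬ S i ⊆ U ∪ V → x ∉ U ∪ V := fun i => by
      by_cases h : S i ⊆ U ∪ V
      · obtain ⟨x, hx⟩ := (hS i).nonempty
        exact ⟨x, hx, fun h' => absurd h h'⟩
      · obtain ⟨x, hx, hxU⟩ := Set.not_subset.mp h
        exact ⟨x, hx, fun _ => hxU⟩
    choose s hs hsU using hchoice
    obtain ⟨x, hx⟩ := F.exists_tendsto s
    have hxA : x ∈ closure (ultralimits F S) := subset_closure ⟨s, hs, hx⟩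
    have hxUV : x ∈ U ∪ V := (hcover hxA).imp (fun h => htU ⟨hxA, h⟩) (fun h => htV ⟨hxA, h⟩)
    obtain ⟨i, hi, hi'⟩ := (hnot.and (hx.eventually ((hU.union hV).mem_nhds hxUV))).exists
    exact hsU i hi hi'
  have key : ∀ {U V : Set X}, IsOpen V → Disjoint U V →
      (closure (ultralimits F S) ∩ V).Nonempty → ¬ ∀ᶠ i in F, S i ⊆ U := by
    rintro U V hV hUV ⟨y, hyA, hyV⟩ hev
    obtain ⟨x, hxV, s, hs, hx⟩ := mem_closure_iff.mp hyA V hV hyV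
    obtain ⟨i, hi, hi'⟩ := (hev.and (hx.eventually (hV.mem_nhds hxV))).exists
    exact Set.disjoint_left.mp hUV (hi (hs i)) hi'
  have hor : ∀ᶠ i in F, S i ⊆ U ∨ S i ⊆ V := hsub.mono fun i hi =>
    (hS i).isPreconnected.subset_or_subset hU hV hUV hi
  rcases Ultrafilter.eventually_or.mp hor with h | h
  · exact key hV hUV (hne'.mono fun x hx => ⟨hx.1, htV hx⟩) h
  · exact key hU hUV.symm (hne.mono fun x hx => ⟨hx.1, htU hx⟩) h

theorem IsChain.closure_of_orderClosed {X : Type*} [TopologicalSpace X] [PartialOrder X]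
    [OrderClosedTopology X] {s : Set X} (hs : IsChain (· ≤ ·) s) :
    IsChain (· ≤ ·) (closure s) := by
  have hclosed : IsClosed {p : X × X | p.1 ≤ p.2 ∨ p.2 ≤ p.1} :=
    (isClosed_le continuous_fst continuous_snd).union (isClosed_le continuous_snd continuous_fst)
  intro x hx y hy _
  have hxy : (x, y) ∈ closure (s ×ˢ s) := by
    rw [closure_prod_eq]
    exact ⟨hx, hy⟩
  refine closure_minimal (fun p hp => ?_) hclosed hxy
  exact hs.total hp.1 hp.2

end Ultralimits

/-! ### The Berkovich space as a compact ordered space -/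

namespace BerkovichSpace

variable {A : Type*} [NormedCommRing A]

theorem isInducing_coe : IsInducing (fun (φ : BerkovichSpace A) (a : A) => φ a) := ⟨rfl⟩

theorem coe_injective : Function.Injective (fun (φ : BerkovichSpace A) (a : A) => φ a) :=
  fun _ _ h => Subtype.ext (DFunLike.coe_injective h)

theorem continuous_eval (a : A) : Continuous fun φ : BerkovichSpace A => φ a :=
  (continuous_apply a).comp isInducing_coe.continuous

theorem tendsto_iff {ι : Type*} {l : Filter ι} {s : ι → BerkovichSpace A}
    {φ : BerkovichSpace A} : Tendsto s l (𝓝 φ) ↔ ∀ a, Tendsto (fun i => s i a) l (𝓝 (φ a)) := by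
  rw [isInducing_coe.tendsto_nhds_iff, tendsto_pi_nhds]
  rfl

theorem le_iff {φ ψ : BerkovichSpace A} : φ ≤ ψ ↔ ∀ a, φ a ≤ ψ a := Iff.rfl

instance : T2Space (BerkovichSpace A) :=
  T2Space.of_injective_continuous coe_injective isInducing_coe.continuous

instance : OrderClosedTopology (BerkovichSpace A) where
  isClosed_le' := by
    have : {p : BerkovichSpace A × BerkovichSpace A | p.1 ≤ p.2} = ⋂ a, {p | p.1 a ≤ p.2 a} := by
      ext p
      simp [le_iff]
    rw [this]
    exact isClosed_iInter fun a => isClosed_le ((continuous_eval a).comp continuous_fst)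
      ((continuous_eval a).comp continuous_snd)

/-- Tychonoff: the seminorms form a closed subset of a product of compact intervals. -/
instance : CompactSpace (BerkovichSpace A) where
  isCompact_univ := by
    rw [isCompact_iff_ultrafilter_le_nhds]
    intro u _
    have hlim : ∀ a : A, ∃ x ∈ Set.Icc 0 ‖a‖, Tendsto (fun φ : BerkovichSpace A => φ a) u (𝓝 x) :=
      fun a => isCompact_Icc.ultrafilter_le_nhds' (u.map fun φ : BerkovichSpace A => φ a)
        (Ultrafilter.mem_map.mpr
          (univ_mem' fun φ : BerkovichSpace A => ⟨apply_nonneg φ.1 a, φ.2 a⟩))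
    choose g hg hlim using hlim
    refine ⟨⟨{ toFun := g
               map_zero' := tendsto_nhds_unique (hlim 0) ?_
               map_one' := tendsto_nhds_unique (hlim 1) ?_
               add_le' := fun a b => le_of_tendsto_of_tendsto' (hlim _)
                ((hlim a).add (hlim b)) fun φ => map_add_le_add φ.1 a b
               neg' := fun a => tendsto_nhds_unique (hlim _) ?_
               map_mul' := fun a b => tendsto_nhds_unique (hlim _) ?_ },
        fun a => (hg a).2⟩, Set.mem_univ _, ?_⟩
    · exact tendsto_const_nhds.congr fun φ => (map_zero φ.1).symm
    · exact (hlim a).congr fun φ => (map_neg_eq_map φ.1 a).symm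
    · exact tendsto_const_nhds.congr fun φ => (map_one φ.1).symm
    · exact ((hlim a).mul (hlim b)).congr fun φ => (map_mul φ.1 a b).symm
    · exact tendsto_iff.mpr hlim

end BerkovichSpace

section DiskPoints

variable {K : Type*} [NontriviallyNormedField K] [CompleteSpace K] [IsUltrametricDist K]
  [IsAlgClosed K]

/-- The point of `𝓜(H^∞)` given by the supremum over the closed disk of center `w` and radius
`r < 1`. -/
def discPoint (w : UnitDisk K) (r : Set.Ico (0 : ℝ) 1) : BerkovichSpace (HInfinity K) :=
  ⟨{ toFun := discSup w r
     map_zero' := le_antisymm (discSup_le r.2.1 fun _ _ => by simp) (discSup_nonneg w r.2.1 _)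
     add_le' := discSup_add_le w r.2.1
     neg' := discSup_neg w r
     map_one' := le_antisymm (discSup_le r.2.1 fun _ _ => by simp)
      (by simpa using norm_center_le_discSup w r.2.1 1)
     map_mul' := discSup_mul w r.2.1 r.2.2 }, discSup_le_norm w r.2.1⟩

theorem discPoint_mono (w : UnitDisk K) : Monotone (discPoint w) := fun r _ h f =>
  discSup_mono w r.2.1 h f

theorem continuous_discPoint (w : UnitDisk K) : Continuous (discPoint w) := by
  rw [BerkovichSpace.isInducing_coe.continuous_iff, continuous_pi_iff]
  exact fun f => continuousOn_iff_continuous_domRestrict.mp (continuousOn_discSup w f)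

theorem isConnected_range_discPoint (w : UnitDisk K) : IsConnected (Set.range (discPoint w)) := by
  have : ConnectedSpace (Set.Ico (0 : ℝ) 1) :=
    isConnected_iff_connectedSpace.mp (isConnected_Ico zero_lt_one)
  exact isConnected_range (continuous_discPoint w)

/-- Ultralimits of disk seminorms with fixed centers are linearly ordered, since an ultrafilter
decides which of two sequences of radii is the larger one. -/
theorem isChain_ultralimits_discPoint {ι : Type*} (F : Ultrafilter ι) (z : ι → UnitDisk K) :
    IsChain (· ≤ ·) (ultralimits F fun i => Set.range (discPoint (z i))) := by
  rintro x ⟨s, hs, hx⟩ y ⟨t, ht, hy⟩ -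
  have hor : ∀ᶠ i in F, s i ≤ t i ∨ t i ≤ s i := Eventually.of_forall fun i => by
    obtain ⟨r, hr⟩ := hs i
    obtain ⟨r', hr'⟩ := ht i
    rw [← hr, ← hr']
    exact (le_total r r').imp (fun h => discPoint_mono _ h) (fun h => discPoint_mono _ h)
  rcases Ultrafilter.eventually_or.mp hor with h | h
  · exact Or.inl (le_of_tendsto_of_tendsto hx hy h)
  · exact Or.inr (le_of_tendsto_of_tendsto hy hx h)

end DiskPoints

/-! ### Infinite products of power series -/

section InfiniteProducts

open PowerSeries

theorem eq_prod_range_mul_tail {M : Type*} [CommMonoid M] {g t : ℕ → M}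
    (h : ∀ k, t k = g k * t (k + 1)) (n : ℕ) : t 0 = (∏ i ∈ Finset.range n, g i) * t n := by
  induction n with
  | zero => simp
  | succ n ih => rw [ih, h n, Finset.prod_range_succ, mul_assoc]

/-- A product of power series converges formally as soon as its factors tend to `1` in the
`X`-adic topology; `T k` is the product of the factors of index at least `k`. -/
theorem PowerSeries.exists_tail_products {R : Type*} [CommRing R] {G : ℕ → PowerSeries R}
    (hG : ∀ n, ∀ᶠ k in atTop, X ^ n ∣ G k - 1) :
    ∃ T : ℕ → PowerSeries R, (∀ k, T k = G k * T (k + 1)) ∧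
      (∀ n, ∀ᶠ k in atTop, X ^ n ∣ T k - 1) ∧
      ∀ k n, ∃ m, coeff n (T k) = coeff n (∏ i ∈ Finset.Ico k m, G i) := by
  simp only [eventually_atTop] at hG
  choose J hJ using hG
  have hstep : ∀ n k m m', k ≤ m → J n ≤ m → m ≤ m' →
      X ^ n ∣ (∏ i ∈ Finset.Ico k m', G i) - ∏ i ∈ Finset.Ico k m, G i := by
    intro n k m m' hkm hJm hmm'
    induction m', hmm' using Nat.le_induction with
    | base => simp
    | succ m' hmm' ih =>
      rw [Finset.prod_Ico_succ_top (hkm.trans hmm')]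
      have e : (∏ i ∈ Finset.Ico k m', G i) * G m' - ∏ i ∈ Finset.Ico k m, G i =
          (∏ i ∈ Finset.Ico k m', G i) * (G m' - 1) +
            ((∏ i ∈ Finset.Ico k m', G i) - ∏ i ∈ Finset.Ico k m, G i) := by ring
      rw [e]
      exact dvd_add ((hJ n m' (hJm.trans hmm')).mul_left _) ih
  have hcoeff : ∀ {n i : ℕ} {A B : PowerSeries R}, X ^ n ∣ A - B → i < n →
      coeff i A = coeff i B := by
    intro n i A B h hi
    have := X_pow_dvd_iff.mp h i hi
    rwa [map_sub, sub_eq_zero] at this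
  set T : ℕ → PowerSeries R := fun k =>
    PowerSeries.mk fun n => coeff n (∏ i ∈ Finset.Ico k (max k (J (n + 1))), G i) with hT
  have hTm : ∀ n k m, k ≤ m → J n ≤ m → X ^ n ∣ T k - ∏ i ∈ Finset.Ico k m, G i := by
    intro n k m hkm hJm
    rw [X_pow_dvd_iff]
    intro i hi
    rw [map_sub, sub_eq_zero, hT, coeff_mk]
    set M := max m (max k (J (i + 1)))
    rw [← hcoeff (hstep n k m M hkm hJm (le_max_left _ _)) hi]
    exact (hcoeff (hstep (i + 1) k _ M (le_max_left _ _) (le_max_right _ _) (le_max_right _ _))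
      (Nat.lt_succ_self i)).symm
  refine ⟨T, fun k => ?_, fun n => ?_, fun k n => ⟨_, coeff_mk _ _⟩⟩
  · ext n
    set m := max (k + 1) (J (n + 1))
    have h1 := hTm (n + 1) k m ((Nat.le_succ k).trans (le_max_left _ _)) (le_max_right _ _)
    have h2 := (hTm (n + 1) (k + 1) m (le_max_left _ _) (le_max_right _ _)).mul_left (G k)
    rw [mul_sub, ← Finset.prod_eq_prod_Ico_succ_bot
      (lt_of_lt_of_le (Nat.lt_succ_self k) (le_max_left _ _))] at h2
    rw [hcoeff h1 (Nat.lt_succ_self n), hcoeff h2 (Nat.lt_succ_self n)]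
  · filter_upwards [eventually_ge_atTop (J n)] with k hk
    simpa using hTm n k k le_rfl hk

variable {K : Type*} [NontriviallyNormedField K] [CompleteSpace K] [IsUltrametricDist K]

omit [CompleteSpace K] in
theorem CoeffBound.prod {G : ℕ → PowerSeries K} {e : ℕ → ℝ}
    (h : ∀ k, CoeffBound (G k) (Real.exp (e k))) (s : Finset ℕ) :
    CoeffBound (∏ i ∈ s, G i) (Real.exp (∑ i ∈ s, e i)) := by
  classical
  induction s using Finset.induction_on with
  | empty => simpa using CoeffBound.one
  | insert i s hi ih =>
    rw [Finset.prod_insert hi, Finset.sum_insert hi, Real.exp_add]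
    exact (h i).mul ih

/-- Convergence of infinite products in `H^∞`: the bounds on the coefficients pass to the formal
product. -/
theorem HInfinity.exists_tail_products {G : ℕ → PowerSeries K} {g : ℕ → HInfinity K} {e : ℕ → ℝ}
    (hg : ∀ k, Represents (G k) (g k)) (hG : ∀ n, ∀ᶠ k in atTop, X ^ n ∣ G k - 1)
    (he : Summable e) (he0 : ∀ k, 0 ≤ e k) (hb : ∀ k, CoeffBound (G k) (Real.exp (e k))) :
    ∃ (T : ℕ → PowerSeries K) (t : ℕ → HInfinity K), (∀ k, Represents (T k) (t k)) ∧
      (∀ k, T k = G k * T (k + 1)) ∧ (∀ k, t k = g k * t (k + 1)) ∧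
      (∀ n, ∀ᶠ k in atTop, X ^ n ∣ T k - 1) ∧ ∀ k, CoeffBound (T k) (Real.exp (∑' i, e i)) := by
  obtain ⟨T, hT, hT1, hTc⟩ := PowerSeries.exists_tail_products hG
  have hTb : ∀ k, CoeffBound (T k) (Real.exp (∑' i, e i)) := fun k n => by
    obtain ⟨m, hm⟩ := hTc k n
    rw [hm]
    exact (CoeffBound.prod hb _ n).trans
      (Real.exp_le_exp.mpr (he.sum_le_tsum _ fun i _ => he0 i))
  choose t ht _ using fun k => (hTb k).exists_represents
  refine ⟨T, t, ht, hT, fun k => (ht k).unique ?_, hT1, hTb⟩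
  have := (hg k).mul (ht (k + 1))
  rwa [← hT] at this

end InfiniteProducts

/-! ### Elements of the kernel of a seminorm below the sup norm -/

section Kernel

open HInfinity

variable {K : Type*} [NontriviallyNormedField K] [CompleteSpace K] [IsUltrametricDist K]

/-- The center of the unit disk. -/
def UnitDisk.origin (K : Type*) [NormedField K] : UnitDisk K := ⟨0, by simp⟩

theorem HInfinity.norm_algebraMap_le (c : K) : ‖algebraMap K (HInfinity K) c‖ ≤ ‖c‖ :=
  (norm_le_iff (norm_nonneg c)).mpr fun _ => le_rfl

theorem tendsto_discSup_norm (f : HInfinity K) :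
    Tendsto (fun R => discSup (UnitDisk.origin K) R f) (𝓝[<] 1) (𝓝 ‖f‖) := by
  refine tendsto_order.mpr ⟨fun a ha => ?_, fun a ha => ?_⟩
  · rcases lt_or_ge a 0 with h0 | h0
    · filter_upwards [Ioo_mem_nhdsLT (zero_lt_one (α := ℝ))] with R hR
      exact h0.trans_le (discSup_nonneg _ hR.1.le f)
    · obtain ⟨z, hz⟩ : ∃ z, a < ‖f.1 z‖ := by
        by_contra! h
        exact absurd ((norm_le_iff h0).mpr h) (not_le.mpr ha)
      filter_upwards [Ioo_mem_nhdsLT z.norm_lt_one] with R hR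
      exact hz.trans_le (norm_apply_le_discSup (by simpa [UnitDisk.origin] using hR.1.le) f)
  · filter_upwards [Ioo_mem_nhdsLT (zero_lt_one (α := ℝ))] with R hR
    exact (discSup_le_norm _ hR.1.le f).trans_lt ha

variable [IsAlgClosed K]

/-- A function that is larger somewhere on the disk of radius `R` than at its center has almost
zeros there, namely roots of the truncations of its power series. -/
theorem HInfinity.exists_norm_apply_le {f : HInfinity K} {R ε : ℝ} (hR : 0 ≤ R) (hR1 : R < 1)
    (hε : 0 < ε) (hf : ‖f.1 (UnitDisk.origin K)‖ < discSup (UnitDisk.origin K) R f) :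
    ∃ b : UnitDisk K, ‖(b : K)‖ ≤ R ∧ ‖f.1 b‖ ≤ ε := by
  obtain ⟨P, hP⟩ := exists_represents f
  set V := discSup (UnitDisk.origin K) R f with hV
  set η := min ε ((V - ‖f.1 (UnitDisk.origin K)‖) / 3) with hη
  have hη0 : 0 < η := lt_min hε (by linarith)
  have hη1 : η ≤ (V - ‖f.1 (UnitDisk.origin K)‖) / 3 := min_le_right _ _
  obtain ⟨k, hk⟩ := (hP.eventually_norm_sub_trunc_le hR1 hη0).exists
  set T := P.trunc k
  have hroot : ∃ b ∈ T.roots, ‖b‖ ≤ R := by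
    by_contra! h
    have h0 : ‖T.eval 0‖ = rootSup T 0 R := by
      rw [norm_eval_eq, rootSup]
      congr 2
      refine Multiset.map_congr rfl fun b hb => ?_
      rw [max_eq_right]
      simpa using (h b hb).le
    have h1 : ‖T.eval 0‖ ≤ ‖f.1 (UnitDisk.origin K)‖ + η := by
      have h := hk (UnitDisk.origin K) (by simpa [UnitDisk.origin] using hR)
      rw [sub_apply, aeval_coord_apply, norm_sub_rev] at h
      have h' := norm_le_norm_add_norm_sub' (T.eval 0) (f.1 (UnitDisk.origin K))
      exact h'.trans (add_le_add_right h _)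
    have h2 : V - η ≤ rootSup T 0 R := by
      have h := discSup_aeval T (UnitDisk.origin K) hR hR1
      have h' := abs_discSup_sub_le (UnitDisk.origin K) hR f (Polynomial.aeval (coord K) T)
      have h'' : discSup (UnitDisk.origin K) R (f - Polynomial.aeval (coord K) T) ≤ η :=
        discSup_le hR fun z hz => hk z (by simpa [UnitDisk.origin] using hz)
      rw [h] at h'
      have := (le_abs_self _).trans (h'.trans h'')
      change V - rootSup T 0 R ≤ η at this
      linarith
    linarith
  obtain ⟨b, hb, hbR⟩ := hroot
  refine ⟨⟨b, mem_ball_zero_iff.mpr (hbR.trans_lt hR1)⟩, hbR, ?_⟩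
  have h := hk ⟨b, mem_ball_zero_iff.mpr (hbR.trans_lt hR1)⟩ hbR
  rw [sub_apply, aeval_coord_apply, (Polynomial.isRoot_of_mem_roots hb).eq_zero, sub_zero] at h
  exact h.trans (min_le_left _ _)

/-- Dividing out almost zeros in the disk of radius `R`. Each division enlarges the supremum over
this disk by a factor close to `1 / R` but not the norm, so the process stops after boundedly many
steps, at a function `q` whose supremum over the disk is attained at the center. -/
theorem HInfinity.exists_quotient {φ : BerkovichSpace (HInfinity K)}
    (hφ : ∀ b : UnitDisk K, 1 ≤ φ (coord K - algebraMap K _ (b : K))) {R : ℝ} (hR : 0 < R)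
    (hR1 : R < 1) (d : ℕ) (f : HInfinity K)
    (hd : R ^ d * ‖f‖ < discSup (UnitDisk.origin K) R f) {ε : ℝ} (hε : 0 < ε) :
    ∃ q : HInfinity K, ‖q‖ ≤ ‖f‖ ∧ φ q ≤ φ f + ε ∧
      discSup (UnitDisk.origin K) R f ≤ ‖q.1 (UnitDisk.origin K)‖ ∧
      discSup (UnitDisk.origin K) R q ≤ ‖q.1 (UnitDisk.origin K)‖ := by
  induction d generalizing f ε with
  | zero =>
    rw [pow_zero, one_mul] at hd
    exact absurd (discSup_le_norm _ hR.le f) (not_le.mpr hd)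
  | succ d ih =>
    rcases le_or_gt (discSup (UnitDisk.origin K) R f) ‖f.1 (UnitDisk.origin K)‖ with h | h
    · exact ⟨f, le_rfl, by linarith, h, h⟩
    set V := discSup (UnitDisk.origin K) R with hV
    have hV0 : 0 < V f := (norm_nonneg _).trans_lt h
    set η := min (ε / 2) (min (V f * (1 - R)) ((V f - R ^ (d + 1) * ‖f‖) / 2)) with hη
    have hη0 : 0 < η :=
      lt_min (half_pos hε) (lt_min (mul_pos hV0 (by linarith)) (by linarith))
    have hη1 : η ≤ ε / 2 := min_le_left _ _
    have hη2 : η ≤ V f * (1 - R) := (min_le_right _ _).trans (min_le_left _ _)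
    have hη3 : η ≤ (V f - R ^ (d + 1) * ‖f‖) / 2 := (min_le_right _ _).trans (min_le_right _ _)
    obtain ⟨b, hbR, hfb⟩ := exists_norm_apply_le hR.le hR1 hη0 h
    obtain ⟨g, hg, hfg⟩ := exists_division f b
    have hconst : ‖algebraMap K (HInfinity K) (f.1 b)‖ ≤ η := (norm_algebraMap_le _).trans hfb
    have hVg : V f ≤ η + R * V g := by
      calc V f = V (algebraMap K _ (f.1 b) + (coord K - algebraMap K _ (b : K)) * g) := by
            rw [← hfg]
        _ ≤ V (algebraMap K _ (f.1 b)) + V ((coord K - algebraMap K _ (b : K)) * g) :=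
            discSup_add_le _ hR.le _ _
        _ ≤ η + V (coord K - algebraMap K _ (b : K)) * V g :=
            add_le_add ((discSup_le_norm _ hR.le _).trans hconst) (discSup_mul_le _ hR.le _ _)
        _ ≤ η + R * V g := by
            gcongr
            · exact discSup_nonneg _ hR.le g
            · refine discSup_le hR.le fun z hz => ?_
              rw [sub_apply, coord_apply, algebraMap_apply]
              exact norm_sub_le_of_le_of_le (by simpa [UnitDisk.origin] using hz) hbR
    have hVfg : V f ≤ V g := le_of_mul_le_mul_left (by linarith : R * V f ≤ R * V g) hR
    have hφg : φ g ≤ φ f + η := by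
      have h1 : (coord K - algebraMap K _ (b : K)) * g = f - algebraMap K _ (f.1 b) :=
        eq_sub_of_add_eq' hfg.symm
      calc φ g ≤ φ (coord K - algebraMap K _ (b : K)) * φ g :=
            le_mul_of_one_le_left (apply_nonneg φ.1 g) (hφ b)
        _ = φ ((coord K - algebraMap K _ (b : K)) * g) := (map_mul φ.1 _ _).symm
        _ ≤ φ f + φ (algebraMap K _ (f.1 b)) := by
            rw [h1]
            exact map_sub_le_add φ.1 _ _
        _ ≤ φ f + η := by
            gcongr
            exact (φ.2 _).trans hconst
    have hRd : R ^ d * ‖g‖ < V g := by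
      refine lt_of_mul_lt_mul_left ?_ hR.le
      have h1 : R * (R ^ d * ‖g‖) ≤ R ^ (d + 1) * ‖f‖ := by
        rw [pow_succ', mul_assoc]
        gcongr
      linarith
    obtain ⟨q, hq1, hq2, hq3, hq4⟩ := ih g hRd (half_pos hε)
    exact ⟨q, hq1.trans hg, by linarith, hVfg.trans hq3, hq4⟩

omit [CompleteSpace K] [IsAlgClosed K] in
/-- If `‖Qᵢ‖ Rⁱ ≤ ‖Q₀‖` for all `i`, the inverse power series satisfies the analogous estimate. -/
theorem PowerSeries.norm_coeff_inv_mul_pow_le {Q : PowerSeries K} {R : ℝ} (hR : 0 ≤ R)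
    (h0 : PowerSeries.coeff 0 Q ≠ 0)
    (hQ : ∀ i, ‖PowerSeries.coeff i Q‖ * R ^ i ≤ ‖PowerSeries.coeff 0 Q‖) (n : ℕ) :
    ‖PowerSeries.coeff n Q⁻¹‖ * R ^ n ≤ ‖PowerSeries.coeff 0 Q‖⁻¹ := by
  induction n using Nat.strong_induction_on with
  | _ n ih =>
    have h0' : ‖PowerSeries.coeff 0 Q‖ ≠ 0 := norm_ne_zero_iff.mpr h0
    rw [PowerSeries.coeff_inv]
    split_ifs with hn
    · rw [hn]
      simp
    · rw [norm_mul, norm_neg, norm_inv, ← PowerSeries.coeff_zero_eq_constantCoeff_apply,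
        mul_assoc]
      refine mul_le_of_le_one_right (by positivity) ?_
      rcases hR.eq_or_lt with rfl | hR
      · rw [zero_pow hn, mul_zero]
        exact zero_le_one
      rw [← le_div_iff₀ (by positivity)]
      refine IsUltrametricDist.norm_sum_le_of_forall_le_of_nonneg (by positivity) fun p hp => ?_
      split_ifs with hlt
      · rw [le_div_iff₀ (by positivity), norm_mul,
          ← Finset.HasAntidiagonal.mem_antidiagonal.mp hp, pow_add]
        calc _ = (‖PowerSeries.coeff p.1 Q‖ * R ^ p.1) *
              (‖PowerSeries.coeff p.2 Q⁻¹‖ * R ^ p.2) := by ring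
          _ ≤ ‖PowerSeries.coeff 0 Q‖ * ‖PowerSeries.coeff 0 Q‖⁻¹ :=
              mul_le_mul (hQ _) (ih _ hlt) (by positivity) (norm_nonneg _)
          _ = 1 := mul_inv_cancel₀ h0'
      · rw [norm_zero]
        positivity

/-- If `φ f < ρ ‖f‖` (of interest for `ρ < 1`), there are `g` with `φ g ≤ ρ` whose norm is as close
to `1`, and whose power series is as close to `1` in the `X`-adic topology, as desired: `g` is the
product of a quotient `q` of `f` without almost zeros in a disk of radius close to `1` and of a
truncation of `1 / q`. -/
theorem HInfinity.exists_factor {φ : BerkovichSpace (HInfinity K)}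
    (hφ : ∀ b : UnitDisk K, 1 ≤ φ (coord K - algebraMap K _ (b : K))) {f : HInfinity K} {ρ : ℝ}
    (hf : φ f < ρ * ‖f‖) (n : ℕ) {ε : ℝ} (hε : 0 < ε) :
    ∃ (G : PowerSeries K) (g : HInfinity K), Represents G g ∧ CoeffBound G (Real.exp ε) ∧
      PowerSeries.X ^ n ∣ G - 1 ∧ φ g ≤ ρ := by
  have hφf : 0 ≤ φ f := apply_nonneg φ.1 f
  have hρf : 0 < ρ * ‖f‖ := hφf.trans_lt hf
  have hf0 : 0 < ‖f‖ := (norm_nonneg f).lt_of_ne fun h => by simp [← h] at hρf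
  have hρ0 : 0 < ρ := pos_of_mul_pos_left hρf hf0.le
  obtain ⟨a, ha1, ha2⟩ := exists_between hf
  have ha0 : 0 < a := hφf.trans_lt ha1
  -- `s` measures the admissible loss in the comparison of `f` with its restriction to a disk.
  set s := max (Real.exp (-ε)) (a / (ρ * ‖f‖)) with hs
  have hs0 : 0 < s := (Real.exp_pos _).trans_le (le_max_left _ _)
  have hs1 : s < 1 := max_lt (by rwa [Real.exp_lt_one_iff, neg_lt_zero]) ((div_lt_one hρf).mpr ha2)
  have hlim : Tendsto (fun R => discSup (UnitDisk.origin K) R f * R ^ n) (𝓝[<] 1)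
      (𝓝 (‖f‖ * 1 ^ n)) := (tendsto_discSup_norm f).mul
    (((continuous_pow n).tendsto 1).mono_left nhdsWithin_le_nhds)
  rw [one_pow, mul_one] at hlim
  obtain ⟨R, hRs, hR, hR1⟩ := ((hlim.eventually_const_lt
    (by nlinarith : s * ‖f‖ < ‖f‖)).and (Ioo_mem_nhdsLT (zero_lt_one (α := ℝ)))).exists
  have hRn : 0 < R ^ n := by positivity
  set V := discSup (UnitDisk.origin K) R f with hV
  have hV0 : 0 < V := pos_of_mul_pos_left ((mul_pos hs0 hf0).trans hRs) hRn.le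
  obtain ⟨d, hd⟩ : ∃ d : ℕ, R ^ d * ‖f‖ < V := by
    have h := (tendsto_pow_atTop_nhds_zero_of_lt_one hR.le hR1).mul_const ‖f‖
    rw [zero_mul] at h
    exact (h.eventually_lt_const hV0).exists
  obtain ⟨q, hq1, hq2, hq3, hq4⟩ := exists_quotient hφ hR hR1 d f hd (sub_pos.mpr ha1)
  obtain ⟨Q, hQ⟩ := exists_represents q
  have hQ0 : q.1 (UnitDisk.origin K) = PowerSeries.coeff 0 Q := hQ.apply_zero
  rw [hQ0] at hq3 hq4
  have hQ0pos : 0 < ‖PowerSeries.coeff 0 Q‖ := hV0.trans_le hq3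
  have hQ0ne : PowerSeries.coeff 0 Q ≠ 0 := norm_pos_iff.mp hQ0pos
  have hW := PowerSeries.norm_coeff_inv_mul_pow_le hR.le hQ0ne fun i =>
    (hQ.norm_coeff_mul_pow_le hR.le hR1 i).trans hq4
  set c := ‖PowerSeries.coeff 0 Q‖⁻¹ / R ^ n with hc
  have hc0 : 0 < c := by positivity
  have hWb : CoeffBound ((PowerSeries.trunc n Q⁻¹ : Polynomial K) : PowerSeries K) c := by
    intro i
    rw [Polynomial.coeff_coe, PowerSeries.coeff_trunc]
    split_ifs with hi
    · rw [hc, le_div_iff₀ hRn]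
      refine le_trans ?_ (hW i)
      gcongr ?_ * ?_
      exact pow_le_pow_of_le_one hR.le hR1.le hi.le
    · rw [norm_zero]
      exact hc0.le
  have hcs : c * (s * ‖f‖) ≤ 1 := by
    rw [hc, div_mul_eq_mul_div, div_le_one hRn, inv_mul_le_iff₀ hQ0pos]
    exact hRs.le.trans (mul_le_mul_of_nonneg_right hq3 hRn.le)
  refine ⟨Q * (PowerSeries.trunc n Q⁻¹ : Polynomial K), _,
    hQ.mul (represents_polynomial _), (hQ.coeffBound.mul hWb).mono ?_, ?_, ?_⟩
  · have h1 : ‖q‖ * c * s ≤ 1 := by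
      refine le_trans ?_ hcs
      calc ‖q‖ * c * s ≤ ‖f‖ * c * s := by gcongr
        _ = c * (s * ‖f‖) := by ring
    have h2 : ‖q‖ * c * Real.exp (-ε) ≤ 1 :=
      (mul_le_mul_of_nonneg_left (le_max_left _ _) (by positivity)).trans h1
    rwa [Real.exp_neg, mul_inv_le_iff₀ (Real.exp_pos _), one_mul] at h2
  · have h1 : Q * Q⁻¹ = 1 := PowerSeries.mul_inv_cancel _ (by
      rwa [← PowerSeries.coeff_zero_eq_constantCoeff_apply])
    rw [← h1, ← mul_sub]
    refine Dvd.dvd.mul_left (PowerSeries.X_pow_dvd_iff.mpr fun i hi => ?_) _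
    rw [map_sub, Polynomial.coeff_coe, PowerSeries.coeff_trunc, if_pos hi, sub_self]
  · have h1 : φ (Polynomial.aeval (coord K) (PowerSeries.trunc n Q⁻¹)) ≤ c :=
      (φ.2 _).trans ((represents_polynomial _).norm_le hWb)
    have h2 : φ q ≤ a := by linarith
    have h3 : a ≤ s * (ρ * ‖f‖) := by
      rw [← div_le_iff₀ hρf]
      exact le_max_right _ _
    calc φ (q * Polynomial.aeval (coord K) (PowerSeries.trunc n Q⁻¹))
        = φ q * φ (Polynomial.aeval (coord K) (PowerSeries.trunc n Q⁻¹)) := map_mul φ.1 _ _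
      _ ≤ s * (ρ * ‖f‖) * c := mul_le_mul (h2.trans h3) h1 (apply_nonneg φ.1 _) (by positivity)
      _ = ρ * (c * (s * ‖f‖)) := by ring
      _ ≤ ρ := mul_le_of_le_one_right hρ0.le hcs

/-- A seminorm that is smaller than the sup norm, but not on linear polynomials, has a nonzero
kernel: it vanishes at a convergent product of factors of norm close to `1` on which it is at most
some `ρ < 1`. -/
theorem BerkovichSpace.ker_ne_bot {φ : BerkovichSpace (HInfinity K)}
    (hφ : ∀ b : UnitDisk K, 1 ≤ φ (coord K - algebraMap K _ (b : K))) {f : HInfinity K}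
    (hf : φ f < ‖f‖) : φ.ker ≠ ⊥ := by
  have hφf : 0 ≤ φ f := apply_nonneg φ.1 f
  have hf0 : 0 < ‖f‖ := hφf.trans_lt hf
  obtain ⟨ρ, hρ1, hρ⟩ := exists_between ((div_lt_one hf0).mpr hf)
  rw [div_lt_iff₀ hf0] at hρ1
  have hρ0 : 0 ≤ ρ := (pos_of_mul_pos_left (hφf.trans_lt hρ1) hf0.le).le
  have he0 : ∀ k : ℕ, (0 : ℝ) < (1 / 2) ^ k := fun k => by positivity
  choose G g hg hGb hG hgρ using fun k : ℕ => exists_factor hφ hρ1 (k + 1) (he0 k)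
  have hGev : ∀ n, ∀ᶠ k in atTop, PowerSeries.X ^ n ∣ G k - 1 := fun n => by
    filter_upwards [eventually_ge_atTop n] with k hk
    exact (pow_dvd_pow _ (hk.trans (Nat.le_succ k))).trans (hG k)
  obtain ⟨T, t, hTt, hT, ht, hT1, hTb⟩ := HInfinity.exists_tail_products hg hGev
    summable_geometric_two (fun k => (he0 k).le) hGb
  have hcoeff : ∀ {n : ℕ} {A : PowerSeries K}, PowerSeries.X ^ (n + 1) ∣ A - 1 →
      PowerSeries.constantCoeff A = 1 := by
    intro n A hA
    have h := PowerSeries.X_pow_dvd_iff.mp hA 0 (Nat.succ_pos n)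
    rwa [map_sub, sub_eq_zero, PowerSeries.coeff_zero_one,
      PowerSeries.coeff_zero_eq_constantCoeff_apply] at h
  have ht0 : t 0 ≠ 0 := by
    intro h0
    obtain ⟨k, hk⟩ := (hT1 1).exists
    have h1 : PowerSeries.constantCoeff (T 0) = 1 := by
      rw [eq_prod_range_mul_tail hT k, map_mul, map_prod,
        Finset.prod_eq_one fun i _ => hcoeff (hG i), hcoeff (n := 0) hk, one_mul]
    have h2 := (hTt 0).apply_zero
    rw [h0, PowerSeries.coeff_zero_eq_constantCoeff_apply, h1] at h2
    exact zero_ne_one h2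
  have hφt : φ (t 0) = 0 := by
    set L := Real.exp (∑' k : ℕ, (1 / 2 : ℝ) ^ k)
    have hle : ∀ n, φ (t 0) ≤ ρ ^ n * L := fun n => by
      rw [eq_prod_range_mul_tail ht n]
      calc φ ((∏ i ∈ Finset.range n, g i) * t n) = φ (∏ i ∈ Finset.range n, g i) * φ (t n) :=
            map_mul φ.1 _ _
        _ = (∏ i ∈ Finset.range n, φ (g i)) * φ (t n) := by
            congr 1
            exact map_prod φ.1 _ _
        _ ≤ ρ ^ n * L := by
            refine mul_le_mul ?_ ((φ.2 _).trans ((hTt n).norm_le (hTb n)))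
              (apply_nonneg φ.1 _) (pow_nonneg hρ0 n)
            refine (Finset.prod_le_prod (fun i _ => apply_nonneg φ.1 (g i))
              fun i _ => hgρ i).trans_eq ?_
            simp
    have hlim := (tendsto_pow_atTop_nhds_zero_of_lt_one hρ0 hρ).mul_const L
    rw [zero_mul] at hlim
    exact le_antisymm (ge_of_tendsto' hlim hle) (apply_nonneg φ.1 _)
  intro hbot
  exact ht0 ((Submodule.eq_bot_iff _).mp hbot (t 0) hφt)

end Kernel

/-! ### Regular sequences -/

section RegularSequences

theorem hasProd_iInf_of_le_one {ι : Type*} {f : ι → ℝ} (h0 : ∀ i, 0 ≤ f i) (h1 : ∀ i, f i ≤ 1) :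
    HasProd f (⨅ s : Finset ι, ∏ i ∈ s, f i) := by
  have hanti : Antitone fun s : Finset ι => ∏ i ∈ s, f i := fun s t hst => by
    classical
    dsimp only
    rw [← Finset.prod_sdiff hst]
    exact mul_le_of_le_one_left (Finset.prod_nonneg fun i _ => h0 i)
      (Finset.prod_le_one (fun i _ => h0 i) fun i _ => h1 i)
  have := tendsto_atTop_ciInf hanti
    ⟨0, by rintro _ ⟨s, rfl⟩; exact Finset.prod_nonneg fun i _ => h0 i⟩
  simpa [HasProd] using this

theorem tprod_nonneg_of_le_one {ι : Type*} {f : ι → ℝ} (h0 : ∀ i, 0 ≤ f i)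
    (h1 : ∀ i, f i ≤ 1) : 0 ≤ ∏' i, f i := by
  rw [(hasProd_iInf_of_le_one h0 h1).tprod_eq]
  exact Real.iInf_nonneg fun s => Finset.prod_nonneg fun i _ => h0 i

theorem tprod_le_prod_of_le_one {ι : Type*} {f : ι → ℝ} (h0 : ∀ i, 0 ≤ f i)
    (h1 : ∀ i, f i ≤ 1) (s : Finset ι) : ∏' i, f i ≤ ∏ i ∈ s, f i := by
  rw [(hasProd_iInf_of_le_one h0 h1).tprod_eq]
  exact ciInf_le ⟨0, by rintro _ ⟨s, rfl⟩; exact Finset.prod_nonneg fun i _ => h0 i⟩ s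

variable {K : Type*} [NontriviallyNormedField K] [IsUltrametricDist K]

theorem UnitDisk.norm_sub_lt_one (x y : UnitDisk K) : ‖(x : K) - y‖ < 1 := by
  have h := norm_sub_le_of_le_of_le (le_max_left ‖(x : K)‖ ‖(y : K)‖) (le_max_right _ _)
  exact h.trans_lt (max_lt x.norm_lt_one y.norm_lt_one)

theorem IsRegularWrt.exists_le_prod {z : ℕ → UnitDisk K} {F : Ultrafilter ℕ}
    (hz : IsRegularWrt z F) : ∃ C ∈ F, ∃ c : ℝ, 0 < c ∧ ∀ n ∈ C, ∀ s : Finset ℕ,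
      (∀ m ∈ s, m ∈ C ∧ m ≠ n) → c ≤ ∏ m ∈ s, ‖(z n : K) - z m‖ := by
  classical
  obtain ⟨C, hC, hpos⟩ := hz
  refine ⟨C, hC, _, hpos, fun n hn s hs => ?_⟩
  have h0 : ∀ n : ℕ, ∀ m : {m : ℕ // m ∈ C ∧ m ≠ n}, 0 ≤ ‖(z n : K) - z m‖ := fun _ _ =>
    norm_nonneg _
  have h1 : ∀ n : ℕ, ∀ m : {m : ℕ // m ∈ C ∧ m ≠ n}, ‖(z n : K) - z m‖ ≤ 1 := fun n m =>
    (UnitDisk.norm_sub_lt_one (z n) (z m)).le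
  refine (ciInf_le (f := fun n : C => ∏' m : {m : ℕ // m ∈ C ∧ m ≠ n}, ‖(z n : K) - z m‖)
    ⟨0, by rintro _ ⟨n, rfl⟩; exact tprod_nonneg_of_le_one (h0 n) (h1 n)⟩ ⟨n, hn⟩).trans ?_
  refine (tprod_le_prod_of_le_one (h0 n) (h1 n) (s.subtype fun m => m ∈ C ∧ m ≠ n)).trans_eq ?_
  rw [Finset.prod_subtype_eq_prod_filter (f := fun m => ‖(z n : K) - z m‖),
    Finset.filter_true_of_mem hs]

theorem Ultrafilter.le_atTop_of_ne_pure {F : Ultrafilter ℕ} (hF : ∀ n : ℕ, F ≠ pure n) :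
    (F : Filter ℕ) ≤ atTop := by
  rw [← Nat.cofinite_eq_atTop]
  refine F.le_cofinite_or_eq_pure.resolve_right ?_
  rintro ⟨n, hn⟩
  exact hF n hn

/-- A regular sequence tends to the unit circle, so fast that `∑ log (1 / ‖zₙ‖) < ∞`. -/
theorem IsRegularWrt.exists_summable {z : ℕ → UnitDisk K} {F : Ultrafilter ℕ}
    (hF : ∀ n : ℕ, F ≠ pure n) (hz : IsRegularWrt z F) :
    ∃ C ∈ F, (∀ n ∈ C, (z n : K) ≠ 0) ∧
      Summable (C.indicator fun n => -Real.log ‖(z n : K)‖) ∧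
      ∃ c : ℝ, 0 < c ∧ ∀ n ∈ C, ∀ s : Finset ℕ,
        (∀ m ∈ s, m ∈ C ∧ m ≠ n) → c ≤ ∏ m ∈ s, ‖(z n : K) - z m‖ := by
  classical
  obtain ⟨C, hC, c, hc, hprod⟩ := hz.exists_le_prod
  obtain ⟨n₀, hn₀⟩ := F.nonempty_of_mem hC
  have hpos : ∀ m ∈ C, m ≠ n₀ → 0 < ‖(z n₀ : K) - z m‖ := fun m hm hne => by
    have := hprod n₀ hn₀ {m} (by simpa using ⟨hm, hne⟩)
    rw [Finset.prod_singleton] at this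
    exact hc.trans_le this
  set D : Set ℕ := {m | m ∈ C ∧ m ≠ n₀} with hD
  set a : ℕ → ℝ := D.indicator fun m => -Real.log ‖(z n₀ : K) - z m‖ with ha
  have ha0 : ∀ m, 0 ≤ a m := fun m => Set.indicator_nonneg (fun m _ => neg_nonneg.mpr
    (Real.log_nonpos (norm_nonneg _) (UnitDisk.norm_sub_lt_one _ _).le)) m
  have hasum : Summable a := by
    refine summable_of_sum_le ha0 (c := -Real.log c) fun s => ?_
    rw [ha, Finset.sum_indicator_eq_sum_filter, Finset.sum_neg_distrib, neg_le_neg_iff,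
      ← Real.log_prod fun m hm => (hpos m (Finset.mem_filter.mp hm).2.1
        (Finset.mem_filter.mp hm).2.2).ne']
    exact Real.log_le_log hc (hprod n₀ hn₀ _ fun m hm => (Finset.mem_filter.mp hm).2)
  have hev : ∀ᶠ m in atTop, m ∈ C → m ≠ n₀ ∧ ‖(z n₀ : K)‖ < ‖(z n₀ : K) - z m‖ := by
    rcases (norm_nonneg (z n₀ : K)).eq_or_lt with h0 | h0
    · filter_upwards [eventually_gt_atTop n₀] with m hm hmC
      rw [← h0]
      exact ⟨hm.ne', hpos m hmC hm.ne'⟩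
    · filter_upwards [eventually_gt_atTop n₀, hasum.tendsto_atTop_zero.eventually_lt_const
        (neg_pos.mpr (Real.log_neg h0 (z n₀).norm_lt_one))] with m hm ham hmC
      refine ⟨hm.ne', ?_⟩
      rw [ha, Set.indicator_of_mem (show m ∈ D from ⟨hmC, hm.ne'⟩), neg_lt_neg_iff] at ham
      exact (Real.log_lt_log_iff h0 (hpos m hmC hm.ne')).mp ham
  obtain ⟨M, hM⟩ := eventually_atTop.mp hev
  have hle : ∀ m ∈ C ∩ Set.Ici M, m ≠ n₀ ∧ 0 < ‖(z n₀ : K) - z m‖ ∧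
      ‖(z n₀ : K) - z m‖ ≤ ‖(z m : K)‖ := by
    rintro m ⟨hmC, hmM⟩
    obtain ⟨hne, hlt⟩ := hM m hmM hmC
    refine ⟨hne, hpos m hmC hne, ?_⟩
    have h := norm_sub_le_of_le_of_le (le_max_left ‖(z n₀ : K)‖ ‖(z m : K)‖) (le_max_right _ _)
    exact (le_max_iff.mp h).resolve_left (not_le.mpr hlt)
  refine ⟨C ∩ Set.Ici M, inter_mem hC (Ultrafilter.le_atTop_of_ne_pure hF (Ici_mem_atTop M)),
    fun n hn => norm_pos_iff.mp ((hle n hn).2.1.trans_le (hle n hn).2.2), ?_, c, hc,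
    fun n hn s hs => hprod n hn.1 s fun m hm => ⟨(hs m hm).1.1, (hs m hm).2⟩⟩
  refine Summable.of_nonneg_of_le (fun m => Set.indicator_nonneg (fun m _ => neg_nonneg.mpr
    (Real.log_nonpos (norm_nonneg _) (z m).norm_lt_one.le)) m) (fun m => ?_) hasum
  by_cases hm : m ∈ C ∩ Set.Ici M
  · obtain ⟨hne, hlt, hle⟩ := hle m hm
    rw [Set.indicator_of_mem hm, ha, Set.indicator_of_mem (show m ∈ D from ⟨hm.1, hne⟩),
      neg_le_neg_iff]
    exact Real.log_le_log hlt hle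
  · rw [Set.indicator_of_notMem hm]
    exact ha0 m

/-- A convergent series stays convergent when its terms are multiplied by suitable integers tending
to infinity. If `t k` are the tails, multipliers of order `1 / √(t k)` do, by telescoping. -/
theorem Summable.exists_tendsto_atTop_mul {a : ℕ → ℝ} (ha : Summable a) (ha0 : ∀ k, 0 ≤ a k) :
    ∃ N : ℕ → ℕ, Tendsto N atTop atTop ∧ Summable fun k => (N k : ℝ) * a k := by
  -- Adding a geometric series makes all terms, hence all tails, positive.
  set b : ℕ → ℝ := fun k => a k + (1 / 2) ^ k with hb
  have hbsum : Summable b := ha.add summable_geometric_two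
  have hb0 : ∀ k, 0 < b k := fun k => add_pos_of_nonneg_of_pos (ha0 k) (by positivity)
  set t : ℕ → ℝ := fun k => ∑' i, b (i + k) with ht
  have htsucc : ∀ k, t k = b k + t (k + 1) := fun k => by
    simp only [ht]
    rw [((summable_nat_add_iff k).mpr hbsum).tsum_eq_zero_add, zero_add]
    simp only [add_assoc, add_comm 1 k]
  have htnn : ∀ k, 0 ≤ t k := fun k => tsum_nonneg fun i => (hb0 _).le
  have htpos : ∀ k, 0 < t k := fun k => by
    rw [htsucc]
    exact add_pos_of_pos_of_nonneg (hb0 k) (htnn _)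
  have htlim : Tendsto t atTop (𝓝 0) := tendsto_sum_nat_add b
  refine ⟨fun k => ⌊1 / √(t k)⌋₊, ?_, ?_⟩
  · refine tendsto_nat_floor_atTop.comp ?_
    simp only [one_div]
    refine Tendsto.inv_tendsto_nhdsGT_zero (tendsto_nhdsWithin_iff.mpr ⟨?_, ?_⟩)
    · simpa using htlim.sqrt
    · exact Eventually.of_forall fun k => Real.sqrt_pos.mpr (htpos k)
  · refine summable_of_sum_range_le (c := 2 * √(t 0)) (fun k => mul_nonneg (Nat.cast_nonneg _)
      (ha0 k)) fun n => ?_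
    have hterm : ∀ k, (⌊1 / √(t k)⌋₊ : ℝ) * a k ≤ 2 * √(t k) - 2 * √(t (k + 1)) := fun k => by
      have h0 := Real.sqrt_pos.mpr (htpos k)
      have h1 := Real.sqrt_nonneg (t (k + 1))
      have h2 : √(t (k + 1)) ≤ √(t k) := Real.sqrt_le_sqrt (by linarith [htsucc k, hb0 k])
      have h3 : b k = (√(t k) - √(t (k + 1))) * (√(t k) + √(t (k + 1))) := by
        linarith [htsucc k, Real.mul_self_sqrt (htnn k), Real.mul_self_sqrt (htnn (k + 1))]
      calc (⌊1 / √(t k)⌋₊ : ℝ) * a k ≤ (1 / √(t k)) * b k := by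
            refine mul_le_mul (Nat.floor_le (by positivity)) ?_ (ha0 k) (by positivity)
            rw [hb]
            exact le_add_of_nonneg_right (by positivity)
        _ ≤ (1 / √(t k)) * ((√(t k) - √(t (k + 1))) * (2 * √(t k))) := by
            rw [h3]
            gcongr
            linarith
        _ = 2 * √(t k) - 2 * √(t (k + 1)) := by
            field_simp
    calc _ ≤ ∑ k ∈ Finset.range n, (2 * √(t k) - 2 * √(t (k + 1))) :=
          Finset.sum_le_sum fun k _ => hterm k
      _ = 2 * √(t 0) - 2 * √(t n) := Finset.sum_range_sub' _ n
      _ ≤ 2 * √(t 0) := by linarith [Real.sqrt_nonneg (t n)]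

end RegularSequences

/-! ### A product vanishing simply along a regular sequence -/

section BlaschkeProduct

open HInfinity

variable {K : Type*} [NontriviallyNormedField K]

theorem CoeffBound.C_mul_X_pow {c : K} {M : ℝ} (hc : ‖c‖ ≤ M) (n : ℕ) :
    CoeffBound (PowerSeries.C c * PowerSeries.X ^ n) M := fun i => by
  rw [PowerSeries.coeff_C_mul, PowerSeries.coeff_X_pow]
  split_ifs
  · simpa using hc
  · simpa using (norm_nonneg c).trans hc

variable [IsUltrametricDist K]

/-- The zeros of `1 + x + ⋯ + x ^ (N - 1) + t x ^ N` for `‖t‖ = 1` lie on the unit circle, and for a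
suitable `t` they avoid the residue classes of finitely many given points. -/
theorem exists_norm_geom_sum_add_ge_one [IsAlgClosed K] (N : ℕ) (hN : N ≠ 0) (S : Multiset K) :
    ∃ t : K, ‖t‖ ≤ 1 ∧ ∀ x : K, (‖x‖ = 1 → x ∈ S) →
      1 ≤ ‖(∑ i ∈ Finset.range N, x ^ i) + t * x ^ N‖ := by
  classical
  obtain ⟨t, ht1, ht⟩ := exists_norm_sub_eq_one
    (0 ::ₘ (S.filter fun x => ‖x‖ = 1).map fun x => -(∑ i ∈ Finset.range N, x ^ i) / x ^ N) (by
      intro c hc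
      rcases Multiset.mem_cons.mp hc with rfl | hc
      · simp
      obtain ⟨x, hx, rfl⟩ := Multiset.mem_map.mp hc
      have hx1 : ‖x‖ = 1 := (Multiset.mem_filter.mp hx).2
      rw [norm_div, norm_neg, norm_pow, hx1, one_pow, div_one]
      refine IsUltrametricDist.norm_sum_le_of_forall_le_of_nonneg zero_le_one fun i _ => ?_
      rw [norm_pow, hx1, one_pow])
  have ht1' : ‖t‖ = 1 := le_antisymm ht1 (by simpa using ht 0 (Multiset.mem_cons_self _ _))
  refine ⟨t, ht1, fun x hx => ?_⟩
  have hfac : (1 - x) * ((∑ i ∈ Finset.range N, x ^ i) + t * x ^ N) =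
      1 + x ^ N * ((t - 1) - t * x) := by
    rw [mul_add, mul_neg_geom_sum]
    ring
  have ht2 : ‖t - 1‖ ≤ 1 := norm_sub_le_of_le_of_le ht1 norm_one.le
  rcases lt_trichotomy ‖x‖ 1 with h | h | h
  · have h1 : ‖x ^ N * ((t - 1) - t * x)‖ < ‖(1 : K)‖ := by
      rw [norm_mul, norm_pow, norm_one]
      refine mul_lt_one_of_nonneg_of_lt_one_left (by positivity) (pow_lt_one₀ (norm_nonneg _) h hN)
        (norm_sub_le_of_le_of_le ht2 ?_)
      rw [norm_mul, ht1', one_mul]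
      exact h.le
    have h2 : ‖1 - x‖ ≤ 1 := norm_sub_le_of_le_of_le norm_one.le h.le
    have h3 := congrArg norm hfac
    rw [norm_mul, norm_add_eq_left_of_norm_lt h1, norm_one] at h3
    rw [← h3]
    exact mul_le_of_le_one_left (norm_nonneg _) h2
  · have hx0 : x ^ N ≠ 0 := pow_ne_zero _ (norm_pos_iff.mp (by rw [h]; exact zero_lt_one))
    have h1 := ht _ (Multiset.mem_cons_of_mem (Multiset.mem_map_of_mem _
      (Multiset.mem_filter.mpr ⟨hx h, h⟩)))
    have h2 : (∑ i ∈ Finset.range N, x ^ i) + t * x ^ N =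
        x ^ N * (t - -(∑ i ∈ Finset.range N, x ^ i) / x ^ N) := by
      field_simp
      ring
    rw [h2, norm_mul, norm_pow, h, one_pow, one_mul]
    exact h1
  · have hx : 0 < ‖x‖ := zero_lt_one.trans h
    have h1 : ‖(t - 1) - t * x‖ = ‖x‖ := by
      have : ‖t * x‖ = ‖x‖ := by rw [norm_mul, ht1', one_mul]
      rw [norm_sub_rev, norm_sub_eq_left_of_norm_lt (by rw [this]; exact ht2.trans_lt h), this]
    have h2 : ‖x ^ N * ((t - 1) - t * x)‖ = ‖x‖ ^ N * ‖x‖ := by rw [norm_mul, norm_pow, h1]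
    have hN1 : 1 ≤ ‖x‖ ^ N := one_le_pow₀ h.le
    have h3 : ‖1 - x‖ = ‖x‖ := by
      rw [norm_sub_rev, norm_sub_eq_left_of_norm_lt (by rwa [norm_one])]
    have h4 : ‖x ^ N * ((t - 1) - t * x) + 1‖ = ‖x‖ ^ N * ‖x‖ := by
      rw [← h2]
      refine norm_add_eq_left_of_norm_lt ?_
      rw [h2, norm_one]
      exact h.trans_le (le_mul_of_one_le_left hx.le hN1)
    have h5 := congrArg norm hfac
    rw [norm_mul, h3, add_comm (1 : K), h4, mul_comm] at h5
    rw [mul_right_cancel₀ hx.ne' h5]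
    exact hN1

variable [CompleteSpace K] [IsAlgClosed K]

theorem discSup_coord_sub (y : UnitDisk K) {r : ℝ} (hr : 0 ≤ r) (hr1 : r < 1) :
    discSup y r (coord K - algebraMap K _ (y : K)) = r := by
  have h := discSup_aeval (Polynomial.X - Polynomial.C (y : K)) y hr hr1
  simpa [rootSup, hr] using h

/-- A factor with a zero at `y`, close to `1` in the `X`-adic topology and of norm close to `1`,
whose remaining zeros are far from the points of `S`. -/
theorem HInfinity.exists_blaschke_factor (y : UnitDisk K) (hy : (y : K) ≠ 0) (N : ℕ) (hN : N ≠ 0)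
    (S : Finset K) :
    ∃ (G : PowerSeries K) (g h : HInfinity K), Represents G g ∧
      CoeffBound G (‖(y : K)‖⁻¹ ^ (N + 1)) ∧ PowerSeries.X ^ N ∣ G - 1 ∧
      g = algebraMap K _ (-(y : K)⁻¹) * (coord K - algebraMap K _ (y : K)) * h ∧
      ∀ u : UnitDisk K, (‖(u : K)‖ = ‖(y : K)‖ → (u : K) ∈ S) → 1 ≤ ‖h.1 u‖ := by
  have hy0 : 0 < ‖(y : K)‖ := norm_pos_iff.mpr hy
  have hy1 : 1 ≤ ‖(y : K)‖⁻¹ := (one_le_inv₀ hy0).mpr y.norm_lt_one.le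
  obtain ⟨t, ht1, ht⟩ := exists_norm_geom_sum_add_ge_one N hN (S.val.map fun u => u / (y : K))
  set x : Polynomial K := Polynomial.C (y : K)⁻¹ * Polynomial.X with hx
  set T : Polynomial K := (∑ i ∈ Finset.range N, x ^ i) + Polynomial.C t * x ^ N with hT
  have hprod : (1 - x) * T = 1 + (Polynomial.C ((t - 1) * (y : K)⁻¹ ^ N) * Polynomial.X ^ N +
      Polynomial.C (-t * (y : K)⁻¹ ^ (N + 1)) * Polynomial.X ^ (N + 1)) := by
    rw [hT, mul_add, mul_neg_geom_sum, hx]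
    simp only [map_mul, map_pow, map_sub, map_neg, map_one]
    ring
  have hG : (((1 - x) * T : Polynomial K) : PowerSeries K) =
      1 + (PowerSeries.C ((t - 1) * (y : K)⁻¹ ^ N) * PowerSeries.X ^ N +
        PowerSeries.C (-t * (y : K)⁻¹ ^ (N + 1)) * PowerSeries.X ^ (N + 1)) := by
    rw [hprod]
    push_cast
    rfl
  refine ⟨_, _, Polynomial.aeval (coord K) T, represents_polynomial ((1 - x) * T), ?_, ?_, ?_, ?_⟩
  · rw [hG]
    refine (CoeffBound.one.mono (one_le_pow₀ hy1)).add
      ((CoeffBound.C_mul_X_pow ?_ _).add (CoeffBound.C_mul_X_pow ?_ _))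
    · rw [norm_mul, norm_pow, norm_inv]
      exact (mul_le_of_le_one_left (by positivity)
        (norm_sub_le_of_le_of_le ht1 norm_one.le)).trans
        (pow_le_pow_right₀ hy1 (Nat.le_succ N))
    · rw [norm_mul, norm_neg, norm_pow, norm_inv]
      exact mul_le_of_le_one_left (by positivity) ht1
  · rw [hG, add_sub_cancel_left]
    exact dvd_add (dvd_mul_left _ _)
      ((pow_dvd_pow _ (Nat.le_succ N)).trans (dvd_mul_left _ _))
  · rw [map_mul]
    congr 1
    refine ext_apply fun u => ?_
    rw [aeval_coord_apply]
    simp only [hx, mul_apply, sub_apply, algebraMap_apply, coord_apply, Polynomial.eval_sub,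
      Polynomial.eval_one, Polynomial.eval_mul, Polynomial.eval_C, Polynomial.eval_X]
    field_simp
    ring
  · intro u hu
    have h := ht ((u : K) / y) (fun h1 => by
      rw [norm_div, div_eq_one_iff_eq hy0.ne'] at h1
      exact Multiset.mem_map_of_mem _ (hu h1))
    rw [aeval_coord_apply, hT]
    simp only [hx, Polynomial.eval_add, Polynomial.eval_finsetSum, Polynomial.eval_mul,
      Polynomial.eval_pow, Polynomial.eval_C, Polynomial.eval_X]
    convert h using 4 <;> ring

omit [IsAlgClosed K] in
theorem Represents.norm_apply_sub_one_le {T : PowerSeries K} {t : HInfinity K}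
    (hT : Represents T t) {L : ℝ} (hL : 1 ≤ L) (hb : CoeffBound T L) {j : ℕ}
    (hj : PowerSeries.X ^ j ∣ T - 1) (w : UnitDisk K) : ‖t.1 w - 1‖ ≤ L * ‖(w : K)‖ ^ j := by
  have hsum := (hT.sub (by simpa using represents_algebraMap (1 : K))) w
  refine norm_le_of_hasSum hsum fun i => ?_
  rcases lt_or_ge i j with h | h
  · rw [PowerSeries.X_pow_dvd_iff.mp hj i h, zero_mul, norm_zero]
    positivity
  · rw [norm_mul, norm_pow, map_sub]
    exact mul_le_mul (norm_sub_le_of_le_of_le (hb i) ((CoeffBound.one i).trans hL))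
      (pow_le_pow_of_le_one (norm_nonneg _) w.norm_lt_one.le h) (by positivity) (by positivity)

/-- For a regular sequence there is `B` in `H^∞` vanishing at its points, whose supremum over a disk
of radius `r` around any of these points is at least a constant times `r`. -/
theorem HInfinity.exists_blaschke_product {z : ℕ → UnitDisk K} {C : Set ℕ}
    (hz0 : ∀ n ∈ C, (z n : K) ≠ 0)
    (hsum : Summable (C.indicator fun n => -Real.log ‖(z n : K)‖)) {c : ℝ}
    (hprod : ∀ n ∈ C, ∀ s : Finset ℕ, (∀ m ∈ s, m ∈ C ∧ m ≠ n) →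
      c ≤ ∏ m ∈ s, ‖(z n : K) - z m‖) :
    ∃ B : HInfinity K, ∀ n ∈ C, B.1 (z n) = 0 ∧ ∀ r, 0 ≤ r → r < 1 → c * r ≤ discSup (z n) r B := by
  classical
  set ℓ : ℕ → ℝ := C.indicator fun n => -Real.log ‖(z n : K)‖ with hℓ
  have hℓ0 : ∀ n, 0 ≤ ℓ n := fun n => Set.indicator_nonneg (fun m _ => neg_nonneg.mpr
    (Real.log_nonpos (norm_nonneg _) (z m).norm_lt_one.le)) n
  obtain ⟨N, hN, hNsum⟩ := hsum.exists_tendsto_atTop_mul hℓ0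
  set e : ℕ → ℝ := fun k => N k * ℓ k + 2 * ℓ k with he
  have hesum : Summable e := hNsum.add (hsum.mul_left 2)
  have he0 : ∀ k, 0 ≤ e k := fun k =>
    add_nonneg (mul_nonneg (Nat.cast_nonneg _) (hℓ0 k)) (mul_nonneg zero_le_two (hℓ0 k))
  -- Only finitely many points of the sequence lie on a given circle.
  have hfin : ∀ k ∈ C, {n | n ∈ C ∧ ‖(z n : K)‖ = ‖(z k : K)‖}.Finite := by
    intro k hk
    have hpos : 0 < ℓ k := by
      rw [hℓ, Set.indicator_of_mem hk, neg_pos]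
      exact Real.log_neg (norm_pos_iff.mpr (hz0 k hk)) (z k).norm_lt_one
    have hev := hsum.tendsto_cofinite_zero.eventually_lt_const hpos
    refine (Filter.eventually_cofinite.mp hev).subset ?_
    rintro n ⟨hn, hnk⟩
    change ¬ ℓ n < ℓ k
    rw [hℓ, Set.indicator_of_mem hk, Set.indicator_of_mem hn, hnk]
    exact lt_irrefl _
  have hfactor : ∀ k, ∃ (G : PowerSeries K) (g : HInfinity K), Represents G g ∧
      CoeffBound G (Real.exp (e k)) ∧ PowerSeries.X ^ N k ∣ G - 1 ∧ (k ∉ C → g = 1) ∧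
      (k ∈ C → g.1 (z k) = 0 ∧ (∀ r, 0 ≤ r → r < 1 → r ≤ discSup (z k) r g) ∧
        ∀ n ∈ C, ‖(z n : K) - z k‖ ≤ ‖g.1 (z n)‖) := by
    intro k
    by_cases hk : k ∈ C
    · obtain ⟨G, g, h, hGg, hGb, hG, hgh, hh⟩ := exists_blaschke_factor (z k) (hz0 k hk) (N k + 1)
        (Nat.succ_ne_zero _) ((hfin k hk).toFinset.image fun n => (z n : K))
      have hy0 : 0 < ‖(z k : K)‖ := norm_pos_iff.mpr (hz0 k hk)
      have hy1 : 1 ≤ ‖(z k : K)‖⁻¹ := (one_le_inv₀ hy0).mpr (z k).norm_lt_one.le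
      have hh' : ∀ n ∈ C, 1 ≤ ‖h.1 (z n)‖ := fun n hn => hh (z n) fun hnk =>
        Finset.mem_image_of_mem (fun n => (z n : K)) ((hfin k hk).mem_toFinset.mpr ⟨hn, hnk⟩)
      refine ⟨G, g, hGg, hGb.mono (le_of_eq ?_), (pow_dvd_pow _ (Nat.le_succ _)).trans hG,
        fun h => absurd hk h, fun _ => ⟨?_, fun r hr hr1 => ?_, fun n hn => ?_⟩⟩
      · have h1 : e k = ((N k + 1 + 1 : ℕ) : ℝ) * -Real.log ‖(z k : K)‖ := by
          rw [he, hℓ]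
          simp only [Set.indicator_of_mem hk]
          push_cast
          ring
        rw [h1, Real.exp_nat_mul, Real.exp_neg, Real.exp_log hy0]
      · rw [hgh]
        simp
      · rw [hgh, discSup_mul _ hr hr1, discSup_mul _ hr hr1, discSup_coord_sub _ hr hr1]
        have h1 : 1 ≤ discSup (z k) r (algebraMap K _ (-(z k : K)⁻¹)) := by
          refine le_trans ?_ (norm_center_le_discSup (z k) hr _)
          rwa [algebraMap_apply, norm_neg, norm_inv]
        have h2 : 1 ≤ discSup (z k) r h := (hh' k hk).trans (norm_center_le_discSup (z k) hr _)
        calc r ≤ discSup (z k) r (algebraMap K _ (-(z k : K)⁻¹)) * r :=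
              le_mul_of_one_le_left hr h1
          _ ≤ _ := le_mul_of_one_le_right (mul_nonneg (zero_le_one.trans h1) hr) h2
      · rw [hgh]
        simp only [mul_apply, sub_apply, algebraMap_apply, coord_apply, norm_mul, norm_neg,
          norm_inv]
        exact (le_mul_of_one_le_left (norm_nonneg _) hy1).trans
          (le_mul_of_one_le_right (by positivity) (hh' n hn))
    · exact ⟨1, 1, by simpa using represents_algebraMap (1 : K),
        CoeffBound.one.mono (Real.one_le_exp (he0 k)), by simp, fun _ => rfl, fun h => absurd h hk⟩
  choose G g hGg hGb hG hg1 hgC using hfactor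
  have hGev : ∀ n, ∀ᶠ k in atTop, PowerSeries.X ^ n ∣ G k - 1 := fun n => by
    filter_upwards [hN.eventually_ge_atTop n] with k hk
    exact (pow_dvd_pow _ hk).trans (hG k)
  obtain ⟨T, t, hTt, -, ht, hT1, hTb⟩ :=
    HInfinity.exists_tail_products hGg hGev hesum he0 hGb
  refine ⟨t 0, fun n hn => ⟨?_, fun r hr hr1 => ?_⟩⟩
  · obtain ⟨q, hq⟩ : g n ∣ t 0 := by
      rw [eq_prod_range_mul_tail ht (n + 1)]
      exact (Finset.dvd_prod_of_mem g (Finset.self_mem_range_succ n)).mul_right _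
    rw [hq, mul_apply, (hgC n hn).1, zero_mul]
  · -- All but finitely many factors can be absorbed in a tail of absolute value `1` at `z n`.
    set L := Real.exp (∑' i, e i)
    have hL : 1 ≤ L := Real.one_le_exp (tsum_nonneg he0)
    obtain ⟨j, hj⟩ : ∃ j : ℕ, L * ‖(z n : K)‖ ^ j < 1 := by
      have h := (tendsto_pow_atTop_nhds_zero_of_lt_one (norm_nonneg _)
        (z n).norm_lt_one).const_mul L
      rw [mul_zero] at h
      exact (h.eventually_lt_const zero_lt_one).exists
    obtain ⟨k, hTk, hkn⟩ := ((hT1 j).and (eventually_gt_atTop n)).exists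
    have htk : 1 ≤ discSup (z n) r (t k) := by
      refine le_trans ?_ (norm_center_le_discSup (z n) hr _)
      have h := ((hTt k).norm_apply_sub_one_le hL (hTb k) hTk (z n)).trans_lt hj
      have h' : ‖(1 : K) + ((t k).1 (z n) - 1)‖ = ‖(1 : K)‖ :=
        norm_add_eq_left_of_norm_lt (by rwa [norm_one])
      rw [add_sub_cancel, norm_one] at h'
      exact h'.ge
    set φ := discPoint (z n) ⟨r, hr, hr1⟩ with hφ
    have hφnn : ∀ f, 0 ≤ φ f := fun f => apply_nonneg φ.1 f
    have hrest : c ≤ ∏ i ∈ (Finset.range k).erase n, φ (g i) := by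
      refine (hprod n hn (((Finset.range k).erase n).filter fun i => i ∈ C) fun m hm => ?_).trans ?_
      · exact ⟨(Finset.mem_filter.mp hm).2, Finset.ne_of_mem_erase (Finset.mem_filter.mp hm).1⟩
      · rw [Finset.prod_filter]
        refine Finset.prod_le_prod (fun i _ => ?_) fun i _ => ?_
        · split_ifs
          · exact norm_nonneg _
          · exact zero_le_one
        · split_ifs with hi
          · exact ((hgC i hi).2.2 n hn).trans (norm_center_le_discSup (z n) hr _)
          · rw [hg1 i hi]
            exact (map_one φ.1).ge
    have hφn : r ≤ φ (g n) := (hgC n hn).2.1 r hr hr1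
    have hmul : φ (t 0) = φ (g n) * (∏ i ∈ (Finset.range k).erase n, φ (g i)) * φ (t k) := by
      rw [Finset.mul_prod_erase _ (fun i => φ (g i)) (Finset.mem_range.mpr hkn),
        eq_prod_range_mul_tail ht k]
      exact (map_mul φ.1 _ _).trans (congrArg (· * φ (t k)) (map_prod φ.1 _ _))
    change c * r ≤ φ (t 0)
    rw [hmul]
    have hnn : 0 ≤ φ (g n) * ∏ i ∈ (Finset.range k).erase n, φ (g i) :=
      mul_nonneg (hφnn _) (Finset.prod_nonneg fun i _ => hφnn _)
    calc c * r ≤ (∏ i ∈ (Finset.range k).erase n, φ (g i)) * φ (g n) :=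
          mul_le_mul hrest hφn hr (Finset.prod_nonneg fun i _ => hφnn _)
      _ = φ (g n) * ∏ i ∈ (Finset.range k).erase n, φ (g i) := mul_comm _ _
      _ ≤ _ := le_mul_of_one_le_right hnn htk

end BlaschkeProduct

/-! ### The chain of seminorms -/

open HInfinity in
theorem theorem2p2 {K : Type*} [NontriviallyNormedField K] [CompleteSpace K]
    [IsUltrametricDist K] [IsAlgClosed K]
    (F : Ultrafilter ℕ) (hF : ∀ n : ℕ, F ≠ pure n)
    (z : ℕ → UnitDisk K) (hz : IsRegularWrt z F) :
    ∃ (A : Set (BerkovichSpace (HInfinity K))) (δ N : BerkovichSpace (HInfinity K)),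
      (∀ f : HInfinity K, Tendsto (fun n => ‖f.1 (z n)‖) F (𝓝 (δ f))) ∧
      (∀ f : HInfinity K, N f = ‖f‖) ∧
      IsChain (· ≤ ·) A ∧ IsCompact A ∧ IsConnected A ∧
      IsLeast A δ ∧ IsGreatest A N ∧
      ∀ φ ∈ A, φ ≠ δ → φ ≠ N → φ.ker ≠ ⊥ ∧ ¬ φ.ker.IsMaximal := by
  obtain ⟨C, hC, hz0, hsum, c, hc, hprod⟩ := hz.exists_summable hF
  obtain ⟨B, hB⟩ := exists_blaschke_product hz0 hsum hprod
  -- The sequence tends to the unit circle.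
  have hznorm : Tendsto (fun n => ‖(z n : K)‖) F (𝓝 1) := by
    have h1 : Tendsto (fun n => Real.exp (-C.indicator (fun n => -Real.log ‖(z n : K)‖) n)) F
        (𝓝 1) := by
      have h := hsum.tendsto_atTop_zero.mono_left (Ultrafilter.le_atTop_of_ne_pure hF)
      simpa [Function.comp_def] using (Real.continuous_exp.tendsto _).comp h.neg
    refine h1.congr' ?_
    filter_upwards [hC] with n hn
    rw [Set.indicator_of_mem hn, neg_neg, Real.exp_log (norm_pos_iff.mpr (hz0 n hn))]
  set P := ultralimits F fun n => Set.range (discPoint (z n)) with hP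
  obtain ⟨δ, hδ⟩ := F.exists_tendsto fun n => discPoint (z n) ⟨0, le_rfl, zero_lt_one⟩
  obtain ⟨N, hN⟩ := F.exists_tendsto fun n =>
    discPoint (z n) ⟨‖(z n : K)‖, norm_nonneg _, (z n).norm_lt_one⟩
  have hδP : δ ∈ P := ⟨_, fun n => Set.mem_range_self _, hδ⟩
  have hNP : N ∈ P := ⟨_, fun n => Set.mem_range_self _, hN⟩
  have hδf : ∀ f : HInfinity K, Tendsto (fun n => ‖f.1 (z n)‖) F (𝓝 (δ f)) := fun f => by
    refine (BerkovichSpace.tendsto_iff.mp hδ f).congr fun n => ?_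
    exact discSup_zero_radius (z n) f
  -- The disk of radius `‖z n‖` around `z n` is centered at the origin.
  have hNf : ∀ f : HInfinity K, N f = ‖f‖ := fun f => by
    have h1 := (tendsto_discSup_norm f).comp (tendsto_nhdsWithin_iff.mpr
      ⟨hznorm, Eventually.of_forall fun n => (z n).norm_lt_one⟩)
    refine tendsto_nhds_unique (BerkovichSpace.tendsto_iff.mp hN f) (h1.congr fun n => ?_)
    refine (discSup_recenter (norm_nonneg _) ?_ f).symm
    simp [UnitDisk.origin]
  have hδle : ∀ φ ∈ closure P, δ ≤ φ := by
    refine fun φ hφ => closure_minimal (t := Set.Ici δ) ?_ isClosed_Ici hφ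
    rintro φ ⟨s, hs, hφ⟩
    refine le_of_tendsto_of_tendsto' hδ hφ fun n => ?_
    obtain ⟨r, hr⟩ := hs n
    rw [← hr]
    exact discPoint_mono (z n) r.2.1
  -- The value at `B` controls the distance from `δ`.
  have hBle : ∀ φ ∈ closure P, ∀ f, c * φ f ≤ c * δ f + φ B * ‖f‖ := by
    intro φ hφ f
    have hclosed : IsClosed {φ : BerkovichSpace (HInfinity K) |
        c * φ f ≤ c * δ f + φ B * ‖f‖} := by
      have hf := BerkovichSpace.continuous_eval f
      have hB := BerkovichSpace.continuous_eval B
      exact isClosed_le (by fun_prop) (by fun_prop)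
    refine closure_minimal ?_ hclosed hφ
    rintro φ ⟨s, hs, hφ⟩
    refine le_of_tendsto_of_tendsto ((BerkovichSpace.tendsto_iff.mp hφ f).const_mul c)
      (((hδf f).const_mul c).add ((BerkovichSpace.tendsto_iff.mp hφ B).mul_const ‖f‖)) ?_
    filter_upwards [hC] with n hn
    obtain ⟨r, hr⟩ := hs n
    rw [← hr]
    calc c * discSup (z n) r f ≤ c * (‖f.1 (z n)‖ + r * ‖f‖) :=
          mul_le_mul_of_nonneg_left (discSup_le_norm_apply_add (z n) r.2.1 f) hc.le
      _ = c * ‖f.1 (z n)‖ + c * r * ‖f‖ := by ring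
      _ ≤ c * ‖f.1 (z n)‖ + discSup (z n) r B * ‖f‖ := by
          have h := (hB n hn).2 r r.2.1 r.2.2
          gcongr
  have hδB : δ B = 0 := by
    refine tendsto_nhds_unique (hδf B) (tendsto_const_nhds.congr' ?_)
    filter_upwards [hC] with n hn
    rw [(hB n hn).1, norm_zero]
  -- All members of the chain agree with the sup norm on linear polynomials.
  have hδlin : ∀ b : UnitDisk K, δ (coord K - algebraMap K _ (b : K)) = 1 := fun b => by
    refine tendsto_nhds_unique (hδf _) (hznorm.congr' ?_)
    filter_upwards [hznorm.eventually_const_lt b.norm_lt_one] with n hn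
    exact (norm_sub_eq_left_of_norm_lt hn).symm
  refine ⟨closure P, δ, N, hδf, hNf, (isChain_ultralimits_discPoint F z).closure_of_orderClosed,
    isClosed_closure.isCompact, ⟨⟨δ, subset_closure hδP⟩, isPreconnected_closure_ultralimits F
      fun n => isConnected_range_discPoint (z n)⟩, ⟨subset_closure hδP, hδle⟩,
    ⟨subset_closure hNP, fun φ _ f => (φ.2 f).trans_eq (hNf f).symm⟩, fun φ hφ hφδ hφN => ?_⟩
  constructor
  · obtain ⟨f, hf⟩ : ∃ f, φ f < ‖f‖ := by
      by_contra! h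
      refine hφN (le_antisymm (fun f => (φ.2 f).trans_eq (hNf f).symm) fun f => ?_)
      exact (hNf f).trans_le (h f)
    exact BerkovichSpace.ker_ne_bot (fun b => (hδlin b).symm.trans_le (hδle φ hφ _)) hf
  · intro hmax
    have hle : φ.ker ≤ δ.ker := fun f (hf : φ f = 0) =>
      le_antisymm ((hδle φ hφ f).trans_eq hf) (apply_nonneg δ.1 f)
    have hne : δ.ker ≠ ⊤ := fun h => by
      have h1 : δ (1 : HInfinity K) = 0 := (Ideal.eq_top_iff_one _).mp h
      rw [show δ (1 : HInfinity K) = 1 from map_one δ.1] at h1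
      exact one_ne_zero h1
    have hBφ : φ B = 0 := by
      have h : B ∈ φ.ker := by
        rw [hmax.eq_of_le hne hle]
        exact hδB
      exact h
    refine hφδ (le_antisymm (fun f => ?_) (hδle φ hφ))
    have h := hBle φ hφ f
    rw [hBφ, zero_mul, add_zero] at h
    exact le_of_mul_le_mul_left h hc

end
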